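/- **Setting.** Let $\Omega\subseteq\mathbb R^{d}$ be open and bounded, and let $E(\mu)=\sum_j f_j(\mu)E_j$, $A(\mu)=\sum_j g_j(\mu)A_j\in\mathbb R^{n\times n}$, $B(\mu)=\sum_j h_j(\mu)B_j\in\mathbb R^{n\times m}$, $C(\mu)=\sum_j k_j(\mu)C_j\in\mathbb R^{p\times n}$ be finite sums with real matrices $E_j,A_j,B_j,C_j$ and real-analytic functions $f_j,g_j,h_j,k_j:\Omega\to\mathbb R$. Put $D(\mu,s)=sE(\mu)-A(\mu)$ and let $H[\mu](s)=C(\mu)D(\mu,s)^{-1}B(\mu)$, a matrix of rational functions of $s$. For $\omega\in\mathbb R$ let $\sigma(\mu,\omega)$ be the largest singular value of $H[\mu](i\omega)$, and $\sigma(\mu,\infty)=\lim_{|\omega|\to\infty}\sigma(\mu,\omega)$. Write $H[\mu]\in\mathcal H_\infty$ if $sE(\mu)-A(\mu)$ is a regular pencil and $\|H[\mu]\|_{\mathcal H_\infty}:=\sup_{\operatorname{Re}s>0}\|H[\mu](s)\|_2<\infty$. For $V,W\in\mathbb C^{n\times r}$ with orthonormal columns, $D^{V,W}(\mu,s)=W^*D(\mu,s)V$,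 $H^{V,W}[\mu](s)=C(\mu)V\,D^{V,W}(\mu,s)^{-1}\,W^*B(\mu)$, and $\sigma^{V,W}(\mu,\omega)$ is the largest singular value of $H^{V,W}[\mu](i\omega)$. Let $\underline\Omega\subseteq\Omega$ be compact with $H[\mu]\in\mathcal H_\infty$ for all $\mu\in\underline\Omega$. **Algorithms.** Start with subspaces $\mathcal V_0,\mathcal W_0\subseteq\mathbb C^n$ of equal dimension. Throughout, $V_j,W_j$ are matrices with equally many columns, which form orthonormal bases of $\mathcal V_j,\mathcal W_j$. For a pair $(\mu,\omega)$ with $D(\mu,i\omega)$ invertible, *expansion at $(\mu,\omega)$* means adding to $\mathcal V$ the column space of $D(\mu,i\omega)^{-1}B(\mu)$ (if $m\le p$) or of $D(\mu,i\omega)^{-1}B(\mu)H[\mu](i\omega)^*$ (if $m>p$), and to $\mathcal W$ the column space of $D(\mu,i\omega)^{-*}C(\mu)^*$ (if $m\ge p$) or of $D(\mu,i\omega)^{-*}C(\mu)^*H[\mu](i\omega)$ (if $m<p$). *Algorithm 1*, step $j=1,2,\dots$: $\mu^{(j)}$ is a minimizer over $\mu\in\underline\Omega$ of $\sup_{\omega\in\mathbb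 R}\sigma^{V_{j-1},W_{j-1}}(\mu,\omega)$ (which is read as $+\infty$ where the reduced transfer function is undefined or unbounded on the imaginary axis, and has to be finite at $\mu^{(j)}$); $\omega^{(j)}\in\mathbb R$ is a maximizer of $\sigma(\mu^{(j)},\cdot)$ over $\mathbb R\cup\{\infty\}$, with $D(\mu^{(j)},i\omega^{(j)})$ invertible; $\mathcal V_j,\mathcal W_j$ arise from $\mathcal V_{j-1},\mathcal W_{j-1}$ by expansion at $(\mu^{(j)},\omega^{(j)})$. *Algorithm 2* is the same, except that in every step $j\ge2$ the subspaces are in addition expanded at $(\mu^{(j,rq)},\omega^{(j,rq)})$ for all $1\le r\le q\le d$, where $\mu^{(j,rq)}=\mu^{(j)}+\|\mu^{(j)}-\mu^{(j-1)}\|_2\,e_{rq}\in\Omega$, $e_{rr}=e_r$, $e_{rq}=(e_r+e_q)/\sqrt2$ for $r\ne q$, and $\omega^{(j,rq)}\in\mathbb R$ is a maximizer of $\sigma(\mu^{(j,rq)},\cdot)$ over $\mathbb R\cup\{\infty\}$, with $D(\mu^{(j,rq)},i\omega^{(j,rq)})$ invertible. **Assumptions.** Let $\mu_*\in\underline\Omega$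 be a local minimizer of $\|H[\cdot]\|_{\mathcal H_\infty}$ on $\underline\Omega$. Assume that $H[\mu]\in\mathcal H_\infty$ for all $\mu$ in a neighbourhood of $\mu_*$, and that $\sigma$, as a function on $\Omega\times(\mathbb R\cup\{\infty\})$, where $\mathbb R\cup\{\infty\}$ is the one-point compactification, is continuous at $(\mu_*,\omega)$ for every $\omega\in\mathbb R\cup\{\infty\}$. Assume that $\sigma(\mu_*,\cdot)$ attains its maximum over $\mathbb R\cup\{\infty\}$ at a unique point $\omega_*\in\mathbb R$, and that $\sigma(\mu_*,\omega_*)>0$ is a simple singular value of $H[\mu_*](i\omega_*)$. Let $\delta<0<\beta$ be such that $\sigma_{\omega\omega}(\mu_*,\omega_*)\le\delta$ and $\sigma_{\min}(D(\mu_*,i\omega_*))\ge\beta$. Assume that the Hessian $\nabla^2\|H[\mu_*]\|_{\mathcal H_\infty}$ is invertible. Fix $k\ge2$ and a family $\mathcal R$ of runs of $k$ steps, either of Algorithm 1 with $d=1$, or of Algorithm 2, such that within $\mathcal R$ both $\mu^{(k)}\to\mu_*$ and $\mu^{(k-1)}\to\mu_*$ as $\mu^{(1)}\to\mu_*$. **Claim.**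 There are $\zeta,\rho,\eta_\mu,\eta_\omega>0$, the same for all runs, with $\overline{\mathcal B}(\mu_*,\eta_\mu)\subseteq\Omega$, such that the following holds for every run in $\mathcal R$ which satisfies $\|\mu^{(1)}-\mu_*\|_2<\rho$, $\mu^{(k)}\neq\mu^{(k-1)}$, $\sigma^{V_k,W_k}_{\omega\omega}(\mu_*,\omega_*)\le\delta$ and $\sigma_{\min}(D^{V_k,W_k}(\mu_*,i\omega_*))\ge\beta$. The point $\mu^{(k)}$ lies in the interior of $\overline{\mathcal B}(\mu_*,\eta_\mu)$, and there is exactly one continuous function $\boldsymbol\omega^{V_k,W_k}:\overline{\mathcal B}(\mu_*,\eta_\mu)\to[\omega_*-\eta_\omega,\omega_*+\eta_\omega]$ which is three times continuously differentiable in the interior and satisfies $\boldsymbol\omega^{V_k,W_k}(\mu^{(k)})=\omega^{(k)}$ and $\sigma^{V_k,W_k}_\omega(\mu,\boldsymbol\omega^{V_k,W_k}(\mu))=0$ for all $\mu$ in the ball. With $\widetilde\sigma^{V_k,W_k}(\mu):=\sigma^{V_k,W_k}(\mu,\boldsymbol\omega^{V_k,W_k}(\mu))$, the functions $\|H[\cdot]\|_{\mathcal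 H_\infty}$ and $\widetilde\sigma^{V_k,W_k}$ are twice continuously differentiable near $\mu^{(k)}$, and 1. $\big\|\nabla^2\|H[\mu^{(k)}]\|_{\mathcal H_\infty}-\nabla^2\widetilde\sigma^{V_k,W_k}(\mu^{(k)})\big\|_2\le\zeta\,\|\mu^{(k)}-\mu^{(k-1)}\|_2$; 2. both $\nabla^2\|H[\mu^{(k)}]\|_{\mathcal H_\infty}$ and $\nabla^2\widetilde\sigma^{V_k,W_k}(\mu^{(k)})$ are invertible; 3. $\big\|[\nabla^2\|H[\mu^{(k)}]\|_{\mathcal H_\infty}]^{-1}-[\nabla^2\widetilde\sigma^{V_k,W_k}(\mu^{(k)})]^{-1}\big\|_2\le\zeta\,\|\mu^{(k)}-\mu^{(k-1)}\|_2$. -/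

import Mathlib

open Set Filter Topology
open scoped Matrix Matrix.Norms.L2Operator OnePoint

noncomputable section

namespace HinfMin

/-- The parameter space `ℝ^d` with the Euclidean norm. -/
abbrev Param (d : ℕ) : Type := EuclideanSpace ℝ (Fin d)

/-! ### Singular values, column spaces, Hessians -/

/-- The largest singular value of a complex matrix. -/
def sigmaMax {a b : ℕ} (M : Matrix (Fin a) (Fin b) ℂ) : ℝ :=
  (Matrix.toEuclideanLin M).singularValues 0

/-- The second largest singular value, counted with multiplicity
(`0` if there is only one singular value). -/
def sigmaSecond {a b : ℕ} (M : Matrix (Fin a) (Fin b) ℂ) : ℝ :=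
  (Matrix.toEuclideanLin M).singularValues 1

/-- The smallest singular value of a square complex matrix. -/
def sigmaMin {a : ℕ} (M : Matrix (Fin a) (Fin a) ℂ) : ℝ :=
  (Matrix.toEuclideanLin M).singularValues (a - 1)

/-- The column space of a matrix. -/
def colSpace {a b : ℕ} (M : Matrix (Fin a) (Fin b) ℂ) : Submodule ℂ (Fin a → ℂ) :=
  LinearMap.range M.mulVecLin

/-- The Hessian matrix of a function of `d` real variables. -/
def hessian {d : ℕ} (F : Param d → ℝ) (x : Param d) : Matrix (Fin d) (Fin d) ℝ :=
  Matrix.of fun i j =>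
    iteratedFDeriv ℝ 2 F x ![EuclideanSpace.single i (1 : ℝ), EuclideanSpace.single j (1 : ℝ)]

/-! ### Descriptor systems and their transfer functions -/

/-- The coefficient matrices of one (complex) descriptor system
`E x' = A x + B u`, `y = C x` with `r` states, `m` inputs and `p` outputs. -/
structure Descriptor (r m p : ℕ) where
  E : Matrix (Fin r) (Fin r) ℂ
  A : Matrix (Fin r) (Fin r) ℂ
  B : Matrix (Fin r) (Fin m) ℂ
  C : Matrix (Fin p) (Fin r) ℂ

namespace Descriptor

variable {r m p : ℕ} (P : Descriptor r m p)

/-- `D(s) = s E - A`. -/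
def D (s : ℂ) : Matrix (Fin r) (Fin r) ℂ := s • P.E - P.A

/-- The pencil `s E - A` is regular. -/
def IsRegular : Prop := ∃ s : ℂ, (P.D s).det ≠ 0

/-- The transfer function `C (s E - A)⁻¹ B`, a matrix of rational functions of `s`
(meaningful for regular pencils). -/
def transfer : Matrix (Fin p) (Fin m) (RatFunc ℂ) :=
  P.C.map RatFunc.C * ((RatFunc.X : RatFunc ℂ) • P.E.map RatFunc.C - P.A.map RatFunc.C)⁻¹ * P.B.map RatFunc.C

/-- The value `H(s)` of the transfer function at a complex number `s`. The entries are evaluated as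
reduced fractions, so removable singularities are removed. -/
def H (s : ℂ) : Matrix (Fin p) (Fin m) ℂ :=
  P.transfer.map (RatFunc.eval (RingHom.id ℂ) s)

/-- `σ(ω)`: the largest singular value of `H(iω)`. -/
def sigma (ω : ℝ) : ℝ := sigmaMax (P.H (Complex.I * ω))

/-- `σ` on `ℝ ∪ {∞}`; the value at `∞` is the limit of `σ(ω)` for `|ω| → ∞`, which exists
for every transfer function that is bounded on the imaginary axis. -/
def sigmaExt (ω : OnePoint ℝ) : ℝ :=
  ω.elim (limUnder (cocompact ℝ) P.sigma) P.sigma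

/-- `ω` is a real number which maximizes `σ` over `ℝ ∪ {∞}`. -/
def IsPeak (ω : ℝ) : Prop := ∀ ω' : OnePoint ℝ, P.sigmaExt ω' ≤ P.sigma ω

/-- The transfer function is well defined and bounded in the open right half plane:
it belongs to `H_∞`. -/
def IsHinf : Prop :=
  P.IsRegular ∧ BddAbove (range fun s : {s : ℂ // 0 < s.re} => ‖P.H s‖)

/-- The `H_∞`-norm of a transfer function in `H_∞`; `‖·‖` is the spectral norm. -/
def hinfNorm : ℝ := ⨆ s : {s : ℂ // 0 < s.re}, ‖P.H s‖

open Classical in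
/-- The `L_∞`-norm as an extended number; it is finite exactly for those systems whose transfer
function is well defined and bounded on the imaginary axis. -/
def linfNorm : ENNReal :=
  if P.IsRegular then ⨆ ω : ℝ, ENNReal.ofReal (P.sigma ω) else ⊤

/-- The column space of the matrix which expands the right subspace at the frequency `ω`:
`D(iω)⁻¹ B` if `m ≤ p`, and `D(iω)⁻¹ B H(iω)^*` if `m > p`. -/
def expandV (ω : ℝ) : Submodule ℂ (Fin r → ℂ) :=
  if m ≤ p then colSpace ((P.D (Complex.I * ω))⁻¹ * P.B)
  else colSpace ((P.D (Complex.I * ω))⁻¹ * P.B * (P.H (Complex.I * ω))ᴴ)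

/-- The column space of the matrix which expands the left subspace at the frequency `ω`:
`D(iω)^{-*} C^*` if `m ≥ p`, and `D(iω)^{-*} C^* H(iω)` if `m < p`. -/
def expandW (ω : ℝ) : Submodule ℂ (Fin r → ℂ) :=
  if p ≤ m then colSpace (((P.D (Complex.I * ω))⁻¹)ᴴ * P.Cᴴ)
  else colSpace (((P.D (Complex.I * ω))⁻¹)ᴴ * P.Cᴴ * P.H (Complex.I * ω))

end Descriptor

/-! ### Parameter-dependent systems and their reductions -/

/-- The data of a parameter-dependent descriptor system
`E(μ) = ∑ f_j(μ) E_j`, `A(μ) = ∑ g_j(μ) A_j`, `B(μ) = ∑ h_j(μ) B_j`, `C(μ) = ∑ k_j(μ) C_j`. -/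
structure ParamSystem (d n m p : ℕ) where
  κE : ℕ
  κA : ℕ
  κB : ℕ
  κC : ℕ
  f : Fin κE → Param d → ℝ
  g : Fin κA → Param d → ℝ
  h : Fin κB → Param d → ℝ
  k : Fin κC → Param d → ℝ
  E : Fin κE → Matrix (Fin n) (Fin n) ℝ
  A : Fin κA → Matrix (Fin n) (Fin n) ℝ
  B : Fin κB → Matrix (Fin n) (Fin m) ℝ
  C : Fin κC → Matrix (Fin p) (Fin n) ℝ

namespace ParamSystem

variable {d n m p : ℕ} (S : ParamSystem d n m p)

/-- All coefficient functions are real analytic on the (open) set `Ω`. -/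
def IsAnalytic (Ω : Set (Param d)) : Prop :=
  (∀ j, AnalyticOnNhd ℝ (S.f j) Ω) ∧ (∀ j, AnalyticOnNhd ℝ (S.g j) Ω) ∧
  (∀ j, AnalyticOnNhd ℝ (S.h j) Ω) ∧ (∀ j, AnalyticOnNhd ℝ (S.k j) Ω)

/-- The full system at the parameter `μ`. -/
def full (μ : Param d) : Descriptor n m p where
  E := ∑ j, (S.f j μ : ℂ) • (S.E j).map Complex.ofReal
  A := ∑ j, (S.g j μ : ℂ) • (S.A j).map Complex.ofReal
  B := ∑ j, (S.h j μ : ℂ) • (S.B j).map Complex.ofReal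
  C := ∑ j, (S.k j μ : ℂ) • (S.C j).map Complex.ofReal

/-- The system at the parameter `μ`, reduced by means of the matrices `V` and `W`. -/
def reduced {r : ℕ} (V W : Matrix (Fin n) (Fin r) ℂ) (μ : Param d) : Descriptor r m p where
  E := ∑ j, (S.f j μ : ℂ) • (Wᴴ * (S.E j).map Complex.ofReal * V)
  A := ∑ j, (S.g j μ : ℂ) • (Wᴴ * (S.A j).map Complex.ofReal * V)
  B := ∑ j, (S.h j μ : ℂ) • (Wᴴ * (S.B j).map Complex.ofReal)
  C := ∑ j, (S.k j μ : ℂ) • ((S.C j).map Complex.ofReal * V)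

end ParamSystem

/-! ### The two greedy algorithms -/

/-- The quantities which occur in a run of one of the algorithms: the iterates `μ^(j)` and `ω^(j)`
for `j ≥ 1`, the bases `V_j`, `W_j` for `j ≥ 0`, and the frequencies `ω^(j,rq)`,
which only the extended algorithm uses. -/
structure Run (d n : ℕ) where
  μ : ℕ → Param d
  ω : ℕ → ℝ
  dim : ℕ → ℕ
  V : (j : ℕ) → Matrix (Fin n) (Fin (dim j)) ℂ
  W : (j : ℕ) → Matrix (Fin n) (Fin (dim j)) ℂ
  ωAdj : ℕ → Fin d → Fin d → ℝ

/-- `e_{rq} = (e_r + e_q) / √2` for `r ≠ q`, and `e_{rr} = e_r`. -/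
def eDir {d : ℕ} (r q : Fin d) : Param d :=
  if r = q then EuclideanSpace.single r (1 : ℝ)
  else (1 / √2 : ℝ) • (EuclideanSpace.single r (1 : ℝ) + EuclideanSpace.single q (1 : ℝ))

/-- The point `μ^(j+1,rq) = μ^(j+1) + ‖μ^(j+1) - μ^(j)‖ e_{rq}`. -/
def Run.adjacent {d n : ℕ} (R : Run d n) (j : ℕ) (r q : Fin d) : Param d :=
  R.μ (j + 1) + ‖R.μ (j + 1) - R.μ j‖ • eDir r q

variable {d n m p : ℕ}

/-- The columns of `V_j` and of `W_j` are orthonormal for all `j ≤ K`. -/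
def Run.Orthonormal (R : Run d n) (K : ℕ) : Prop :=
  ∀ j ≤ K, (R.V j)ᴴ * R.V j = 1 ∧ (R.W j)ᴴ * R.W j = 1

/-- Step `j + 1` computes `μ^(j+1)` and `ω^(j+1)`: `μ^(j+1)` minimizes the norm of the
transfer function reduced to `V_j`, `W_j` over `Ωc`, and `ω^(j+1)` maximizes `σ(μ^(j+1), ·)`. -/
structure Run.Iterate (S : ParamSystem d n m p) (Ωc : Set (Param d)) (R : Run d n) (j : ℕ) :
    Prop where
  mem : R.μ (j + 1) ∈ Ωc
  finite : (S.reduced (R.V j) (R.W j) (R.μ (j + 1))).linfNorm ≠ ⊤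
  minimal : IsMinOn (fun ν => (S.reduced (R.V j) (R.W j) ν).linfNorm) Ωc (R.μ (j + 1))
  invertible : IsUnit ((S.full (R.μ (j + 1))).D (Complex.I * R.ω (j + 1)))
  peak : (S.full (R.μ (j + 1))).IsPeak (R.ω (j + 1))

/-- `R` consists of `K` steps of the basic greedy algorithm. -/
structure IsBasicRun (S : ParamSystem d n m p) (Ωc : Set (Param d)) (K : ℕ) (R : Run d n) :
    Prop where
  orthonormal : R.Orthonormal K
  iterate : ∀ j < K, R.Iterate S Ωc j
  expandV : ∀ j < K, colSpace (R.V (j + 1)) =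
    colSpace (R.V j) ⊔ (S.full (R.μ (j + 1))).expandV (R.ω (j + 1))
  expandW : ∀ j < K, colSpace (R.W (j + 1)) =
    colSpace (R.W j) ⊔ (S.full (R.μ (j + 1))).expandW (R.ω (j + 1))

/-- `R` consists of `K` steps of the extended greedy algorithm: from the second step on, the
subspaces are also expanded at the points `μ^(j+1,rq)`, `r ≤ q`. -/
structure IsExtendedRun (S : ParamSystem d n m p) (Ω Ωc : Set (Param d)) (K : ℕ) (R : Run d n) :
    Prop where
  orthonormal : R.Orthonormal K
  iterate : ∀ j < K, R.Iterate S Ωc j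
  adjacent_mem : ∀ j < K, 1 ≤ j → ∀ r q : Fin d, r ≤ q → R.adjacent j r q ∈ Ω
  adjacent_invertible : ∀ j < K, 1 ≤ j → ∀ r q : Fin d, r ≤ q →
    IsUnit ((S.full (R.adjacent j r q)).D (Complex.I * R.ωAdj (j + 1) r q))
  adjacent_peak : ∀ j < K, 1 ≤ j → ∀ r q : Fin d, r ≤ q →
    (S.full (R.adjacent j r q)).IsPeak (R.ωAdj (j + 1) r q)
  expandV : ∀ j < K, colSpace (R.V (j + 1)) =
    colSpace (R.V j) ⊔ (S.full (R.μ (j + 1))).expandV (R.ω (j + 1)) ⊔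
      ⨆ (_ : 1 ≤ j) (r : Fin d) (q : Fin d) (_ : r ≤ q),
        (S.full (R.adjacent j r q)).expandV (R.ωAdj (j + 1) r q)
  expandW : ∀ j < K, colSpace (R.W (j + 1)) =
    colSpace (R.W j) ⊔ (S.full (R.μ (j + 1))).expandW (R.ω (j + 1)) ⊔
      ⨆ (_ : 1 ≤ j) (r : Fin d) (q : Fin d) (_ : r ≤ q),
        (S.full (R.adjacent j r q)).expandW (R.ωAdj (j + 1) r q)

/-! ### The frequency branch of the reduced system -/

/-- `w` is a continuous function from the closed ball of radius `ημ` around `μs` to the closed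
interval of radius `ηω` around `ωs` which is three times continuously differentiable in the interior
of the ball, takes the value `ωk` at `μk`, and satisfies `s_ω(μ, w(μ)) = 0` in the whole ball. -/
structure IsFrequencyBranch (s : Param d → ℝ → ℝ) (μs : Param d) (ωs ημ ηω : ℝ)
    (μk : Param d) (ωk : ℝ) (w : Param d → ℝ) : Prop where
  continuousOn : ContinuousOn w (Metric.closedBall μs ημ)
  mapsTo : MapsTo w (Metric.closedBall μs ημ) (Metric.closedBall ωs ηω)
  contDiffOn : ContDiffOn ℝ 3 w (interior (Metric.closedBall μs ημ))
  value : w μk = ωk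
  stationary : ∀ μ ∈ Metric.closedBall μs ημ, HasDerivAt (s μ) 0 (w μ)

end HinfMin

end

/-!
At an interpolation point the singular value function of the reduced system agrees to first order
with `σ`, since the error of a Petrov-Galerkin projection is a product of a left and a right
residual, both of which vanish there. Along the stationary frequency branch of the reduced system,
which the implicit function theorem provides, the difference of `‖H[·]‖_{H_∞}` and the reduced
singular value thus vanishes to first order at `μ^(k)`, and it vanishes at points at distance
`h = ‖μ^(k) - μ^(k-1)‖` in the directions `± e_{rq}`. By Rolle's theorem its second derivative in
such a direction has a zero within distance `h` of `μ^(k)`, so it is `O(h)` at `μ^(k)`, and by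
polarization so is the Hessian. The constants are uniform over all runs because the orthonormal
bases `V`, `W` with `σ_min(W^* D V) ≥ β` form a compact set: near each of its points, either the
reduced singular value is jointly smooth in `V`, `W`, `μ` and `ω`, or nothing is interpolated.
-/

namespace HinfMin

theorem eventually_forall_mem_closedBall {ι X Y : Type*} [TopologicalSpace X]
    [PseudoMetricSpace Y] {l : Filter ι} {u : ι → X} {r : ι → ℝ} {x₀ : X} {y₀ : Y}
    (hu : Tendsto u l (𝓝 x₀)) (hr : Tendsto r l (𝓝 0)) {P : X × Y → Prop}
    (hP : ∀ᶠ z in 𝓝 (x₀, y₀), P z) :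
    ∀ᶠ i in l, ∀ y ∈ Metric.closedBall y₀ (r i), P (u i, y) := by
  obtain ⟨p, hp, q, hq, hpq⟩ := eventually_prod_iff.1 (nhds_prod_eq (x := x₀) (y := y₀) ▸ hP)
  obtain ⟨ε, hε, hball⟩ := Metric.eventually_nhds_iff_ball.1 hq
  filter_upwards [hu.eventually hp, hr.eventually_lt_const hε] with i hi hri y hy
  exact hpq hi (hball y (Metric.closedBall_subset_ball hri hy))

section Calculus

variable {E : Type*} [NormedAddCommGroup E] [NormedSpace ℝ E]

theorem exists_fderiv_fderiv_eq_zero {f : E → ℝ} {x v : E}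
    (hf : ∀ y ∈ segment ℝ x (x + v), ContDiffAt ℝ 2 f y) (hv : f x = f (x + v))
    (hd : fderiv ℝ f x v = 0) :
    ∃ y ∈ segment ℝ x (x + v), fderiv ℝ (fderiv ℝ f) y v v = 0 := by
  have hseg : ∀ t ∈ Icc (0 : ℝ) 1, x + t • v ∈ segment ℝ x (x + v) := fun t ht => by
    rw [segment_eq_image']
    exact ⟨t, ht, by simp⟩
  have hline : ∀ t : ℝ, HasDerivAt (fun t : ℝ => x + t • v) v t := fun t => by
    simpa using ((hasDerivAt_id t).smul_const v).const_add x
  have hderiv₁ : ∀ t ∈ Icc (0 : ℝ) 1,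
      HasDerivAt (fun t => f (x + t • v)) (fderiv ℝ f (x + t • v) v) t := fun t ht =>
    ((hf _ (hseg t ht)).differentiableAt (by simp)).hasFDerivAt.comp_hasDerivAt t (hline t)
  have hderiv₂ : ∀ t ∈ Icc (0 : ℝ) 1, HasDerivAt (fun t => fderiv ℝ f (x + t • v) v)
      (fderiv ℝ (fderiv ℝ f) (x + t • v) v v) t := fun t ht => by
    have hfd := ((hf _ (hseg t ht)).fderiv_right (m := 1) (by norm_num)).differentiableAt (by simp)
    have hcomp : HasDerivAt (fun t => fderiv ℝ f (x + t • v))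
        (fderiv ℝ (fderiv ℝ f) (x + t • v) v) t := hfd.hasFDerivAt.comp_hasDerivAt t (hline t)
    simpa using hcomp.clm_apply (hasDerivAt_const t v)
  obtain ⟨a, ha, hfa⟩ := exists_hasDerivAt_eq_zero one_pos
    (fun t ht => (hderiv₁ t ht).continuousAt.continuousWithinAt) (by simpa using hv)
    (fun t ht => hderiv₁ t (Ioo_subset_Icc_self ht))
  have hsub : Icc 0 a ⊆ Icc (0 : ℝ) 1 := Icc_subset_Icc_right ha.2.le
  obtain ⟨b, hb, hfb⟩ := exists_hasDerivAt_eq_zero ha.1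
    (fun t ht => (hderiv₂ t (hsub ht)).continuousAt.continuousWithinAt) (by simp [hd, hfa])
    (fun t ht => hderiv₂ t (hsub (Ioo_subset_Icc_self ht)))
  exact ⟨_, hseg b (hsub (Ioo_subset_Icc_self hb)), hfb⟩

theorem exists_abs_fderiv_fderiv_le {f : E → ℝ} {x₀ : E} (hf : ContDiffAt ℝ 3 f x₀) :
    ∃ K : ℝ, 0 ≤ K ∧ ∀ᶠ z : E × E in 𝓝 (x₀, 0), f z.1 = f (z.1 + z.2) → fderiv ℝ f z.1 z.2 = 0 →
      |fderiv ℝ (fderiv ℝ f) z.1 z.2 z.2| ≤ K * ‖z.2‖ ^ 3 := by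
  have hf₂ : ContDiffAt ℝ 1 (fderiv ℝ (fderiv ℝ f)) x₀ :=
    (hf.fderiv_right (m := 2) (by norm_num)).fderiv_right (by norm_num)
  obtain ⟨K, u, hu, hK⟩ := hf₂.exists_lipschitzOnWith
  obtain ⟨ε, hε, hball⟩ := Metric.mem_nhds_iff.1
    (inter_mem hu ((hf.of_le (by norm_num)).eventually (n := 2) (by simp)))
  have hadd : Tendsto (fun z : E × E => z.1 + z.2) (𝓝 (x₀, 0)) (𝓝 x₀) :=
    Continuous.tendsto' (by fun_prop) _ _ (by simp)
  refine ⟨K, K.2, ?_⟩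
  filter_upwards [hadd.eventually_mem (Metric.ball_mem_nhds x₀ hε),
    continuousAt_fst.eventually_mem (Metric.ball_mem_nhds x₀ hε)]
  rintro ⟨x, v⟩ hxv hx hv hd
  have hseg := (convex_ball x₀ ε).segment_subset hx hxv
  obtain ⟨y, hy, hy₀⟩ := exists_fderiv_fderiv_eq_zero (fun y hy => (hball (hseg hy)).2) hv hd
  have hxy : ‖x - y‖ ≤ ‖v‖ := by
    have := norm_sub_le_of_mem_segment hy
    rwa [norm_sub_rev, add_sub_cancel_left] at this
  have hLip : ‖fderiv ℝ (fderiv ℝ f) x - fderiv ℝ (fderiv ℝ f) y‖ ≤ K * ‖v‖ := by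
    have := hK.dist_le_mul x (hball hx).1 y (hball (hseg hy)).1
    rw [dist_eq_norm, dist_eq_norm] at this
    exact this.trans (by gcongr)
  calc |fderiv ℝ (fderiv ℝ f) x v v|
      = ‖(fderiv ℝ (fderiv ℝ f) x - fderiv ℝ (fderiv ℝ f) y) v v‖ := by
        simp [hy₀]
    _ ≤ ‖fderiv ℝ (fderiv ℝ f) x - fderiv ℝ (fderiv ℝ f) y‖ * ‖v‖ * ‖v‖ :=
        ContinuousLinearMap.le_opNorm₂ _ v v
    _ ≤ K * ‖v‖ * ‖v‖ * ‖v‖ := by gcongr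
    _ = K * ‖v‖ ^ 3 := by ring

/-- The partial derivative with respect to the last, real, variable. -/
noncomputable def derivSnd (Φ : E × ℝ → ℝ) (z : E × ℝ) : ℝ := fderiv ℝ Φ z (0, 1)

theorem contDiffAt_derivSnd {Φ : E × ℝ → ℝ} {z : E × ℝ} {k l : WithTop ℕ∞}
    (hΦ : ContDiffAt ℝ l Φ z) (hk : k + 1 ≤ l) : ContDiffAt ℝ k (derivSnd Φ) z :=
  (hΦ.fderiv_right hk).clm_apply contDiffAt_const

theorem hasDerivAt_derivSnd {Φ : E × ℝ → ℝ} {z : E × ℝ} (hΦ : DifferentiableAt ℝ Φ z) :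
    HasDerivAt (fun ω => Φ (z.1, ω)) (derivSnd Φ z) z.2 :=
  hΦ.hasFDerivAt.comp_hasDerivAt z.2 ((hasDerivAt_const z.2 z.1).prodMk (hasDerivAt_id z.2))

theorem hasDerivAt_zero_iff_derivSnd_eq_zero {Φ : E × ℝ → ℝ} {z : E × ℝ}
    (hΦ : DifferentiableAt ℝ Φ z) :
    HasDerivAt (fun ω => Φ (z.1, ω)) 0 z.2 ↔ derivSnd Φ z = 0 :=
  ⟨(hasDerivAt_derivSnd hΦ).unique, fun h => h ▸ hasDerivAt_derivSnd hΦ⟩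

theorem iteratedDeriv_two_eq_derivSnd {Φ : E × ℝ → ℝ} {z : E × ℝ} (hΦ : ContDiffAt ℝ 2 Φ z) :
    iteratedDeriv 2 (fun ω => Φ (z.1, ω)) z.2 = derivSnd (derivSnd Φ) z := by
  have hderiv : deriv (fun ω => Φ (z.1, ω)) =ᶠ[𝓝 z.2] fun ω => derivSnd Φ (z.1, ω) := by
    have hslice : Tendsto (fun ω => (z.1, ω)) (𝓝 z.2) (𝓝 z) :=
      Continuous.tendsto' (by fun_prop) _ _ rfl
    filter_upwards [hslice.eventually (hΦ.eventually (by simp))] with ω hω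
    exact (hasDerivAt_derivSnd (hω.differentiableAt (by simp))).deriv
  rw [iteratedDeriv_succ, iteratedDeriv_one, hderiv.deriv_eq]
  exact (hasDerivAt_derivSnd
    ((contDiffAt_derivSnd (k := 1) hΦ (by norm_num)).differentiableAt (by simp))).deriv

theorem exists_implicit_scalar [CompleteSpace E] {Ψ : E × ℝ → ℝ} {x₀ : E} {t₀ : ℝ}
    {k : WithTop ℕ∞} (hk : k ≠ 0) (hΨ : ContDiffAt ℝ k Ψ (x₀, t₀)) (h₀ : Ψ (x₀, t₀) = 0)
    (h₁ : derivSnd Ψ (x₀, t₀) ≠ 0) :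
    ∃ g : E → ℝ, ContDiffAt ℝ k g x₀ ∧ g x₀ = t₀ ∧
      ∀ᶠ z in 𝓝 (x₀, t₀), Ψ z = 0 ↔ g z.1 = z.2 := by
  have hinv : (fderiv ℝ Ψ (x₀, t₀) ∘L .inr ℝ E ℝ).IsInvertible := by
    refine ⟨ContinuousLinearEquiv.unitsEquivAut ℝ (Units.mk0 _ h₁), ?_⟩
    ext
    simp [derivSnd]
  refine ⟨hΨ.implicitFunction hk hinv, hΨ.contDiffAt_implicitFunction hk hinv,
    hΨ.implicitFunction_apply_self hk hinv, ?_⟩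
  simpa [h₀] using hΨ.eventually_apply_eq_iff_implicitFunction hk hinv

theorem exists_stationary_branch [CompleteSpace E] {Φ : E × ℝ → ℝ} {x₀ : E} {ω₀ : ℝ}
    {k : WithTop ℕ∞} (hk : 1 ≤ k) (hΦ : ContDiffAt ℝ (k + 1) Φ (x₀, ω₀))
    (h₁ : derivSnd Φ (x₀, ω₀) = 0) (h₂ : derivSnd (derivSnd Φ) (x₀, ω₀) ≠ 0) :
    ∃ g : E → ℝ, ContDiffAt ℝ k g x₀ ∧ g x₀ = ω₀ ∧
      ∀ᶠ z in 𝓝 (x₀, ω₀), HasDerivAt (fun ω => Φ (z.1, ω)) 0 z.2 ↔ g z.1 = z.2 := by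
  obtain ⟨g, hg, hg₀, hiff⟩ := exists_implicit_scalar (one_pos.trans_le hk).ne'
    (contDiffAt_derivSnd hΦ le_rfl) h₁ h₂
  refine ⟨g, hg, hg₀, ?_⟩
  have hΦ₁ : ContDiffAt ℝ 1 Φ (x₀, ω₀) := hΦ.of_le (hk.trans le_self_add)
  filter_upwards [hiff, hΦ₁.eventually (by simp)] with z hz hΦz
  rw [hasDerivAt_zero_iff_derivSnd_eq_zero (hΦz.differentiableAt (by simp)), hz]

end Calculus

section Hessian

variable {d : ℕ} {T : Type*} [NormedAddCommGroup T] [NormedSpace ℝ T]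

theorem hessian_apply {F : Param d → ℝ} {x : Param d} (i j : Fin d) :
    hessian F x i j = fderiv ℝ (fderiv ℝ F) x (EuclideanSpace.single i 1)
      (EuclideanSpace.single j 1) := by
  simp [hessian, iteratedFDeriv_two_apply]

theorem hessian_sub {F G : Param d → ℝ} {x : Param d} (hF : ContDiffAt ℝ 2 F x)
    (hG : ContDiffAt ℝ 2 G x) :
    hessian (fun y => F y - G y) x = hessian F x - hessian G x := by
  have h := iteratedFDeriv_sub_apply hF hG
  ext i j
  exact congrArg (fun L => L ![EuclideanSpace.single i 1, EuclideanSpace.single j 1]) h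

theorem continuousAt_hessian {F : Param d → ℝ} {x : Param d} (hF : ContDiffAt ℝ 2 F x) :
    ContinuousAt (hessian F) x := by
  refine continuousAt_pi.2 fun i => continuousAt_pi.2 fun j => ?_
  simp only [hessian_apply]
  exact ((((hF.fderiv_right (m := 1) (by norm_num)).fderiv_right (m := 0)
    (by norm_num)).continuousAt).clm_apply continuousAt_const).clm_apply continuousAt_const

theorem hasFDerivAt_slice {F : Type*} [NormedAddCommGroup F] [NormedSpace ℝ F]
    {E : Type*} [NormedAddCommGroup E] [NormedSpace ℝ E]
    {f : T × E → F} {y : T × E} (hf : DifferentiableAt ℝ f y) :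
    HasFDerivAt (fun ν => f (y.1, ν)) (fderiv ℝ f y ∘L .inr ℝ T E) y.2 :=
  hf.hasFDerivAt.comp y.2 (hasFDerivAt_prodMk_right y.1 y.2)

theorem hessian_slice {f : T × Param d → ℝ} {y : T × Param d} (hf : ContDiffAt ℝ 2 f y)
    (i j : Fin d) :
    hessian (fun ν => f (y.1, ν)) y.2 i j = fderiv ℝ (fderiv ℝ f) y
      (0, EuclideanSpace.single i 1) (0, EuclideanSpace.single j 1) := by
  have hslice : Tendsto (fun ν => (y.1, ν)) (𝓝 y.2) (𝓝 y) :=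
    Continuous.tendsto' (by fun_prop) _ _ rfl
  have hfderiv : fderiv ℝ (fun ν => f (y.1, ν)) =ᶠ[𝓝 y.2] fun ν =>
      fderiv ℝ f (y.1, ν) ∘L .inr ℝ T (Param d) := by
    filter_upwards [hslice.eventually (hf.eventually (by simp))] with ν hν
    exact (hasFDerivAt_slice (y := (y.1, ν)) (hν.differentiableAt (by simp))).fderiv
  have hsnd := hasFDerivAt_slice
    ((hf.fderiv_right (m := 1) (by norm_num)).differentiableAt (by simp))
  rw [hessian_apply, hfderiv.fderiv_eq, (hsnd.clm_comp (hasFDerivAt_const _ _)).fderiv]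
  simp

theorem norm_eDir (r q : Fin d) : ‖eDir r q‖ = 1 := by
  unfold eDir
  split_ifs with h
  · simp
  · have hsq : ‖(EuclideanSpace.single r (1 : ℝ) + EuclideanSpace.single q (1 : ℝ) : Param d)‖ ^ 2
        = 2 := by
      rw [norm_add_sq_real]
      simp [EuclideanSpace.inner_single_left, h]
      norm_num
    rw [norm_smul, ← Real.sqrt_eq_iff_eq_sq (by norm_num) (norm_nonneg _) |>.2 hsq.symm]
    simp [abs_of_nonneg]

theorem abs_le_of_eDir {B : Param d →L[ℝ] Param d →L[ℝ] ℝ} (hB : ∀ x y, B x y = B y x) {c : ℝ}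
    (hc : ∀ r q : Fin d, r ≤ q → |B (eDir r q) (eDir r q)| ≤ c) (i j : Fin d) :
    |B (EuclideanSpace.single i 1) (EuclideanSpace.single j 1)| ≤ 2 * c := by
  have hdiag : ∀ i, |B (EuclideanSpace.single i 1) (EuclideanSpace.single i 1)| ≤ c := fun i => by
    simpa [eDir] using hc i i le_rfl
  wlog hij : i ≤ j generalizing i j
  · exact hB _ _ ▸ this j i (le_of_not_ge hij)
  obtain rfl | hlt := hij.eq_or_lt
  · linarith [hdiag i, abs_nonneg (B (EuclideanSpace.single i 1) (EuclideanSpace.single i 1))]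
  have hsqrt : (√2)⁻¹ * (√2)⁻¹ = (1 / 2 : ℝ) := by
    rw [← mul_inv, Real.mul_self_sqrt (by norm_num), one_div]
  have hpolar : B (eDir i j) (eDir i j) =
      (1 / 2) * (B (EuclideanSpace.single i 1) (EuclideanSpace.single i 1) +
        2 * B (EuclideanSpace.single i 1) (EuclideanSpace.single j 1) +
        B (EuclideanSpace.single j 1) (EuclideanSpace.single j 1)) := by
    simp only [eDir, hlt.ne, if_false, one_div, map_smul, map_add, _root_.smul_apply,
      _root_.add_apply, smul_eq_mul]
    rw [hB (EuclideanSpace.single j 1) (EuclideanSpace.single i 1)]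
    linear_combination (B (EuclideanSpace.single i 1) (EuclideanSpace.single i 1) +
      2 * B (EuclideanSpace.single i 1) (EuclideanSpace.single j 1) +
      B (EuclideanSpace.single j 1) (EuclideanSpace.single j 1)) * hsqrt
  have hdir := abs_le.1 (hpolar ▸ hc i j hij)
  have hi := abs_le.1 (hdiag i)
  have hj := abs_le.1 (hdiag j)
  rw [abs_le]
  constructor <;> linarith

theorem exists_norm_le_of_entries (a b : ℕ) : ∃ K : ℝ, 0 ≤ K ∧ ∀ (M : Matrix (Fin a) (Fin b) ℝ)
    (c : ℝ), (∀ i j, |M i j| ≤ c) → ‖M‖ ≤ K * c := by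
  refine ⟨∑ i, ∑ j, ‖(Matrix.single i j (1 : ℝ) : Matrix (Fin a) (Fin b) ℝ)‖, by positivity,
    fun M c hc => ?_⟩
  have hsingle : ∀ i j, ‖Matrix.single i j (M i j)‖ ≤
      ‖(Matrix.single i j (1 : ℝ) : Matrix (Fin a) (Fin b) ℝ)‖ * c := fun i j => by
    rw [← mul_one (M i j), ← smul_eq_mul, ← Matrix.smul_single, norm_smul, mul_comm]
    gcongr
    exact hc i j
  calc ‖M‖ = ‖∑ i, ∑ j, Matrix.single i j (M i j)‖ := by rw [← Matrix.matrix_eq_sum_single]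
    _ ≤ ∑ i, ∑ j, ‖Matrix.single i j (M i j)‖ :=
      (norm_sum_le _ _).trans (Finset.sum_le_sum fun i _ => norm_sum_le _ _)
    _ ≤ ∑ i, ∑ j, ‖(Matrix.single i j (1 : ℝ) : Matrix (Fin a) (Fin b) ℝ)‖ * c := by
      gcongr with i _ j _
      exact hsingle i j
    _ = _ := by simp only [Finset.sum_mul]

theorem exists_norm_le_of_eDir (d : ℕ) : ∃ K : ℝ, 0 ≤ K ∧
    ∀ B : Param d →L[ℝ] Param d →L[ℝ] ℝ, (∀ x y, B x y = B y x) →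
      ∀ c, (∀ r q : Fin d, r ≤ q → |B (eDir r q) (eDir r q)| ≤ c) →
      ‖Matrix.of fun i j => B (EuclideanSpace.single i 1) (EuclideanSpace.single j 1)‖ ≤ K * c := by
  obtain ⟨K, hK, hentries⟩ := exists_norm_le_of_entries d d
  refine ⟨K * 2, by positivity, fun B hB c hc => ?_⟩
  rw [mul_assoc]
  exact hentries _ _ fun i j => abs_le_of_eDir hB hc i j

theorem exists_norm_hessian_le_of_vanishing {f : T × Param d → ℝ} {y₀ : T × Param d}
    (hf : ContDiffAt ℝ 3 f y₀) :
    ∃ K : ℝ, 0 ≤ K ∧ ∀ᶠ z : (T × Param d) × ℝ in 𝓝 (y₀, 0), 0 < z.2 →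
      f z.1 = 0 → HasFDerivAt (fun ν => f (z.1.1, ν)) (0 : Param d →L[ℝ] ℝ) z.1.2 →
      ∀ s : Fin d → Fin d → ℝ, (∀ r q, |s r q| = z.2) →
      (∀ r q, r ≤ q → f (z.1.1, z.1.2 + s r q • eDir r q) = 0) →
      ‖hessian (fun ν => f (z.1.1, ν)) z.1.2‖ ≤ K * z.2 := by
  obtain ⟨L, hL, hbound⟩ := exists_abs_fderiv_fderiv_le hf
  obtain ⟨K, hK, hnorm⟩ := exists_norm_le_of_eDir d
  refine ⟨K * L, by positivity, ?_⟩
  filter_upwards [continuousAt_fst.eventually (hf.eventually (by simp)),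
    eventually_forall_mem_closedBall (l := 𝓝 (y₀, (0 : ℝ))) continuousAt_fst continuousAt_snd
      hbound]
  rintro ⟨y, h⟩ hfy hball (hh : 0 < h) (hf₀ : f y = 0) hfd s hs hfs
  set B : Param d →L[ℝ] Param d →L[ℝ] ℝ :=
    (fderiv ℝ (fderiv ℝ f) y).bilinearComp (.inr ℝ T (Param d)) (.inr ℝ T (Param d)) with hB
  have hdir : ∀ r q : Fin d, r ≤ q → |B (eDir r q) (eDir r q)| ≤ L * h := fun r q hrq => by
    set v : T × Param d := ContinuousLinearMap.inr ℝ T (Param d) (s r q • eDir r q) with hv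
    have hvh : ‖v‖ = h := by
      simp [hv, norm_smul, norm_eDir, hs, hh.le]
    have hvB : fderiv ℝ (fderiv ℝ f) y v v = h ^ 2 * B (eDir r q) (eDir r q) := by
      simp only [hv, map_smul, _root_.smul_apply, smul_eq_mul, hB,
        ContinuousLinearMap.bilinearComp_apply]
      rw [← mul_assoc, ← sq, ← sq_abs, hs]
    have hyv : y + v = (y.1, y.2 + s r q • eDir r q) := by ext1 <;> simp [hv]
    have hy := hball v (by simp [hvh]) (by rw [hyv, hfs r q hrq, hf₀])
      (congrArg (· (s r q • eDir r q))
        ((hasFDerivAt_slice (hfy.differentiableAt (by simp))).unique hfd))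
    rw [hvB, hvh, abs_mul, abs_of_pos (by positivity)] at hy
    refine le_of_mul_le_mul_left (hy.trans_eq ?_) (pow_pos hh 2)
    ring
  have hhess : hessian (fun ν => f (y.1, ν)) y.2 = Matrix.of fun i j =>
      B (EuclideanSpace.single i 1) (EuclideanSpace.single j 1) := by
    ext i j
    exact hessian_slice (hfy.of_le (by norm_num)) i j
  rw [hhess, mul_assoc]
  exact hnorm B (fun u v => hfy.isSymmSndFDerivAt (by simp; norm_num) _ _) _ hdir

end Hessian

section Inverse

theorem exists_norm_inv_sub_inv_le {ι : Type*} [Fintype ι] [DecidableEq ι] {A₀ : Matrix ι ι ℝ}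
    (hA₀ : IsUnit A₀) :
    ∃ K : ℝ, ∀ᶠ X in 𝓝 (A₀, A₀),
      IsUnit X.1 ∧ IsUnit X.2 ∧ ‖X.1⁻¹ - X.2⁻¹‖ ≤ K * ‖X.1 - X.2‖ := by
  have : CompleteSpace (Matrix ι ι ℝ) := FiniteDimensional.complete ℝ _
  obtain ⟨u, rfl⟩ := hA₀
  obtain ⟨K, s, hs, hK⟩ := (contDiffAt_ringInverse ℝ u (n := 1)).exists_lipschitzOnWith
  have hgood : ∀ᶠ X in 𝓝 (u : Matrix ι ι ℝ), IsUnit X ∧ X ∈ s := inter_mem (Units.nhds u) hs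
  refine ⟨K, ?_⟩
  filter_upwards [hgood.prod_nhds hgood] with X ⟨hX₁, hX₂⟩
  refine ⟨hX₁.1, hX₂.1, ?_⟩
  simpa only [Matrix.nonsing_inv_eq_ringInverse, dist_eq_norm] using hK.dist_le_mul _ hX₁.2 _ hX₂.2

end Inverse

section HessianError

theorem tendsto_fst_pow {Θ : Type*} [TopologicalSpace Θ] (θ₀ : Θ) {k : ℕ}
    (hk : k ≠ 0) :
    Tendsto (fun x : ℝ × Θ => x.1 ^ k) (𝓝[>] 0 ×ˢ 𝓝 θ₀) (𝓝 0) := by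
  have : Tendsto (fun t : ℝ => t ^ k) (𝓝 0) (𝓝 0) :=
    Continuous.tendsto' (by fun_prop) _ _ (zero_pow hk)
  exact (this.mono_left nhdsWithin_le_nhds).comp tendsto_fst

variable {d : ℕ} {Θ : Type*} [NormedAddCommGroup Θ] [NormedSpace ℝ Θ]

/-- The function `φ` of parameter and frequency agrees to first order with the function `F` of the
parameter alone: equal values, equal parameter derivatives, and vanishing frequency derivative. -/
def AgreesToFirstOrderAt (φ : Param d × ℝ → ℝ) (F : Param d → ℝ) (z : Param d × ℝ) : Prop :=
  φ z = F z.1 ∧ HasFDerivAt φ (fderiv ℝ F z.1 ∘L .fst ℝ (Param d) ℝ) z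

theorem AgreesToFirstOrderAt.hasDerivAt {φ : Param d × ℝ → ℝ} {F : Param d → ℝ} {z : Param d × ℝ}
    (h : AgreesToFirstOrderAt φ F z) : HasDerivAt (fun ω => φ (z.1, ω)) 0 z.2 := by
  have hderiv : HasDerivAt (fun ω => φ (z.1, ω))
      ((fderiv ℝ F z.1 ∘L .fst ℝ (Param d) ℝ) (0, 1)) z.2 :=
    h.2.comp_hasDerivAt z.2 ((hasDerivAt_const z.2 z.1).prodMk (hasDerivAt_id z.2))
  simpa using hderiv

theorem AgreesToFirstOrderAt.hasFDerivAt_comp {φ : Param d × ℝ → ℝ} {F γ : Param d → ℝ}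
    {μ : Param d} (h : AgreesToFirstOrderAt φ F (μ, γ μ)) (hγ : DifferentiableAt ℝ γ μ) :
    HasFDerivAt (fun ν => φ (ν, γ ν)) (fderiv ℝ F μ) μ :=
  HasFDerivAt.comp (g := φ) (f := fun ν => (ν, γ ν)) μ h.2
    ((hasFDerivAt_id μ).prodMk hγ.hasFDerivAt)

/-- The stationary frequency branch `w` of `φ` through `(μk, ωk)` exists and is unique, and the
Hessian of `φ` along `w` approximates the Hessian of `F` at `μk` up to the error `ε`. -/
def TracksHessian (φ : Param d → ℝ → ℝ) (F : Param d → ℝ) (μs : Param d) (ωs ημ ηω : ℝ)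
    (μk : Param d) (ωk ε : ℝ) : Prop :=
  ∃ w : Param d → ℝ, IsFrequencyBranch φ μs ωs ημ ηω μk ωk w ∧
    (∀ w', IsFrequencyBranch φ μs ωs ημ ηω μk ωk w' → EqOn w' w (Metric.closedBall μs ημ)) ∧
    ContDiffAt ℝ 2 (fun μ => φ μ (w μ)) μk ∧
    ‖hessian F μk - hessian (fun μ => φ μ (w μ)) μk‖ ≤ ε

/-- Whenever `μ` near `μs` and its neighbours at distance `h` in the directions `± eDir r q` are
interpolation points, that is, belong to `I`, the Hessian is tracked at `μ` up to an error of
order `h`. The size of all neighbourhoods and of the constant is governed by the scale `t`: the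
frequency radius is `t`, the parameter radius is `t ^ 2`, the points are taken from a ball of radius
`t ^ 3`, and the constant is `t⁻¹`. -/
def HasHessianBound (φ : Param d → ℝ → ℝ) (F G : Param d → ℝ) (I : Set (Param d)) (μs : Param d)
    (t : ℝ) : Prop :=
  ∀ μ ∈ Metric.ball μs (t ^ 3), ∀ h ∈ Ioo 0 (t ^ 3), ∀ s : Fin d → Fin d → ℝ,
    (∀ r q, |s r q| = h) → μ ∈ I → (∀ r q, r ≤ q → μ + s r q • eDir r q ∈ I) →
    TracksHessian φ F μs (G μs) (t ^ 2) t μ (G μ) (t⁻¹ * h)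

theorem eventually_mapsTo_closedBall {g : Θ × Param d → ℝ} {G : Param d → ℝ} {θ₀ : Θ}
    {μs : Param d} (hg : ContDiffAt ℝ 1 g (θ₀, μs)) (hG : ContDiffAt ℝ 1 G μs) :
    ∀ᶠ x : ℝ × Θ in 𝓝[>] 0 ×ˢ 𝓝 θ₀, ∀ μ ∈ Metric.closedBall μs (x.1 ^ 2), g (x.2, μ) = G μ →
      MapsTo (fun ν => g (x.2, ν)) (Metric.closedBall μs (x.1 ^ 2))
        (Metric.closedBall (G μs) x.1) := by
  obtain ⟨K, u, hu, hK⟩ := hg.exists_lipschitzOnWith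
  obtain ⟨L, v, hv, hL⟩ := hG.exists_lipschitzOnWith
  have hv' : ∀ᶠ y : Θ × Param d in 𝓝 (θ₀, μs), y.2 ∈ v := continuousAt_snd.eventually hv
  have hsmall : ∀ᶠ t : ℝ in 𝓝[>] 0, 0 < t ∧ (2 * K + L) * t < 1 := by
    have hlim : Tendsto (fun t : ℝ => (2 * K + L) * t) (𝓝[>] 0) (𝓝 0) :=
      (Continuous.tendsto' (by fun_prop) _ _ (by simp)).mono_left nhdsWithin_le_nhds
    exact eventually_mem_nhdsWithin.and (hlim.eventually_lt_const one_pos)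
  filter_upwards [tendsto_fst.eventually hsmall, eventually_forall_mem_closedBall tendsto_snd
    (tendsto_fst_pow θ₀ two_ne_zero) (hv'.and hu)]
  rintro ⟨t, θ⟩ ⟨ht, hKL⟩ hball μ hμ hgG ν hν
  have hgν : dist (g (θ, ν)) (g (θ, μ)) ≤ K * dist ν μ := by
    simpa using hK.dist_le_mul _ (hball ν hν).2 _ (hball μ hμ).2
  have hGμ := hL.dist_le_mul μ (hball μ hμ).1 μs (mem_of_mem_nhds hv)
  have hνμ : dist ν μ ≤ t ^ 2 + t ^ 2 :=
    (dist_triangle_right ν μ μs).trans (add_le_add hν hμ)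
  calc dist (g (θ, ν)) (G μs) ≤ dist (g (θ, ν)) (g (θ, μ)) + dist (G μ) (G μs) :=
        hgG ▸ dist_triangle _ _ _
    _ ≤ K * (t ^ 2 + t ^ 2) + L * t ^ 2 := by
        gcongr
        · exact hgν.trans (by gcongr)
        · exact hGμ.trans (by gcongr; exact hμ)
    _ = t * ((2 * K + L) * t) := by ring
    _ ≤ t := mul_le_of_le_one_right ht.le hKL.le

theorem eventually_isFrequencyBranch {Φ : (Θ × Param d) × ℝ → ℝ} {g : Θ × Param d → ℝ}
    {G : Param d → ℝ} {θ₀ : Θ} {μs : Param d} (hg : ContDiffAt ℝ 3 g (θ₀, μs))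
    (hG : ContDiffAt ℝ 1 G μs)
    (hiff : ∀ᶠ z in 𝓝 ((θ₀, μs), G μs), HasDerivAt (fun ω => Φ (z.1, ω)) 0 z.2 ↔ g z.1 = z.2) :
    ∀ᶠ x : ℝ × Θ in 𝓝[>] 0 ×ˢ 𝓝 θ₀, ∀ μ ∈ Metric.closedBall μs (x.1 ^ 2), g (x.2, μ) = G μ →
      IsFrequencyBranch (fun ν ω => Φ ((x.2, ν), ω)) μs (G μs) (x.1 ^ 2) x.1 μ (G μ)
        (fun ν => g (x.2, ν)) ∧
      ∀ w, IsFrequencyBranch (fun ν ω => Φ ((x.2, ν), ω)) μs (G μs) (x.1 ^ 2) x.1 μ (G μ) w →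
        EqOn w (fun ν => g (x.2, ν)) (Metric.closedBall μs (x.1 ^ 2)) := by
  have hassoc : Tendsto (fun z : Θ × Param d × ℝ => ((z.1, z.2.1), z.2.2)) (𝓝 (θ₀, μs, G μs))
      (𝓝 ((θ₀, μs), G μs)) := Continuous.tendsto' (by fun_prop) _ _ rfl
  filter_upwards [eventually_mapsTo_closedBall (hg.of_le (by norm_num)) hG,
    eventually_forall_mem_closedBall tendsto_snd (tendsto_fst_pow θ₀ two_ne_zero)
      (hg.eventually (by simp)),
    eventually_forall_mem_closedBall tendsto_snd (by simpa using tendsto_fst_pow θ₀ one_ne_zero)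
      (hassoc.eventually hiff),
    tendsto_fst.eventually (Ioo_mem_nhdsGT one_pos)]
  rintro ⟨t, θ⟩ hmaps hgc hstat ⟨ht₀, ht₁⟩ μ hμ hgG
  have hstat' : ∀ ν ∈ Metric.closedBall μs (t ^ 2), ∀ ω ∈ Metric.closedBall (G μs) t,
      HasDerivAt (fun ω => Φ ((θ, ν), ω)) 0 ω ↔ g (θ, ν) = ω := fun ν hν ω hω => by
    refine hstat (ν, ω) ?_
    rw [← closedBall_prod_same]
    exact ⟨Metric.closedBall_subset_closedBall (pow_le_of_le_one ht₀.le ht₁.le two_ne_zero) hν, hω⟩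
  have hgc' : ∀ ν ∈ Metric.closedBall μs (t ^ 2), ContDiffAt ℝ 3 (fun ν => g (θ, ν)) ν :=
    fun ν hν => (hgc ν hν).comp (g := g) ν (contDiffAt_const.prodMk contDiffAt_id)
  refine ⟨⟨fun ν hν => (hgc' ν hν).continuousAt.continuousWithinAt, hmaps μ hμ hgG,
    fun ν hν => (hgc' ν (interior_subset hν)).contDiffWithinAt, hgG,
    fun ν hν => (hstat' ν hν _ (hmaps μ hμ hgG hν)).2 rfl⟩,
    fun w hw ν hν => ((hstat' ν hν _ (hw.mapsTo hν)).1 (hw.stationary ν hν)).symm⟩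

theorem eventually_vanishes_of_agreesToFirstOrderAt {Φ : (Θ × Param d) × ℝ → ℝ}
    {g : Θ × Param d → ℝ} {F G : Param d → ℝ} {I : Θ → Set (Param d)} {θ₀ : Θ} {μs : Param d}
    (hg : ContDiffAt ℝ 1 g (θ₀, μs)) (hF : ContDiffAt ℝ 1 F μs) (hG : ContinuousAt G μs)
    (hiff : ∀ᶠ z in 𝓝 ((θ₀, μs), G μs), HasDerivAt (fun ω => Φ (z.1, ω)) 0 z.2 ↔ g z.1 = z.2)
    (hI : ∀ᶠ y in 𝓝 (θ₀, μs), y.2 ∈ I y.1 →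
      AgreesToFirstOrderAt (fun z => Φ ((y.1, z.1), z.2)) F (y.2, G y.2)) :
    ∀ᶠ y in 𝓝 (θ₀, μs), y.2 ∈ I y.1 → g y = G y.2 ∧ F y.2 - Φ (y, g y) = 0 ∧
      HasFDerivAt (fun ν => F ν - Φ ((y.1, ν), g (y.1, ν))) (0 : Param d →L[ℝ] ℝ) y.2 := by
  have hlift : Tendsto (fun y : Θ × Param d => (y, G y.2)) (𝓝 (θ₀, μs)) (𝓝 ((θ₀, μs), G μs)) :=
    tendsto_id.prodMk_nhds (hG.comp (f := Prod.snd) continuousAt_snd)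
  filter_upwards [hI, hlift.eventually hiff, hg.eventually (by simp),
    continuousAt_snd.eventually (hF.eventually (by simp))]
  rintro ⟨θ, μ⟩ hIy hiffy hgy hFy hy
  have hagree := hIy hy
  have hgG : g (θ, μ) = G μ := hiffy.1 hagree.hasDerivAt
  have hγ : DifferentiableAt ℝ (fun ν => g (θ, ν)) μ :=
    (hasFDerivAt_slice (y := (θ, μ)) (hgy.differentiableAt (by simp))).differentiableAt
  dsimp only at hagree
  rw [← hgG] at hagree
  refine ⟨hgG, sub_eq_zero.2 hagree.1.symm, ?_⟩
  simpa only [sub_self] using (hFy.differentiableAt (by simp)).hasFDerivAt.fun_sub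
    (hagree.hasFDerivAt_comp (γ := fun ν => g (θ, ν)) hγ)

theorem eventually_hasHessianBound_of_branch {Φ : (Θ × Param d) × ℝ → ℝ} {g : Θ × Param d → ℝ}
    {F G : Param d → ℝ} {I : Θ → Set (Param d)} {θ₀ : Θ} {μs : Param d}
    (hΦ : ContDiffAt ℝ 3 Φ ((θ₀, μs), G μs)) (hF : ContDiffAt ℝ 3 F μs) (hG : ContDiffAt ℝ 1 G μs)
    (hg : ContDiffAt ℝ 3 g (θ₀, μs)) (hg₀ : g (θ₀, μs) = G μs)
    (hiff : ∀ᶠ z in 𝓝 ((θ₀, μs), G μs), HasDerivAt (fun ω => Φ (z.1, ω)) 0 z.2 ↔ g z.1 = z.2)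
    (hI : ∀ᶠ y in 𝓝 (θ₀, μs), y.2 ∈ I y.1 →
      AgreesToFirstOrderAt (fun z => Φ ((y.1, z.1), z.2)) F (y.2, G y.2)) :
    ∀ᶠ x : ℝ × Θ in 𝓝[>] 0 ×ˢ 𝓝 θ₀,
      HasHessianBound (fun ν ω => Φ ((x.2, ν), ω)) F G (I x.2) μs x.1 := by
  have hΦg : ContDiffAt ℝ 3 (fun y => Φ (y, g y)) (θ₀, μs) := by
    rw [← hg₀] at hΦ
    exact ContDiffAt.comp (g := Φ) (f := fun y => (y, g y)) _ hΦ (contDiffAt_id.prodMk hg)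
  have hf : ContDiffAt ℝ 3 (fun y => F y.2 - Φ (y, g y)) (θ₀, μs) :=
    (hF.comp _ contDiffAt_snd).sub hΦg
  obtain ⟨K, -, hbound⟩ := exists_norm_hessian_le_of_vanishing hf
  have hassoc : Tendsto (fun z : Θ × Param d × ℝ => ((z.1, z.2.1), z.2.2)) (𝓝 (θ₀, μs, 0))
      (𝓝 ((θ₀, μs), 0)) := Continuous.tendsto' (by fun_prop) _ _ rfl
  filter_upwards [tendsto_fst.eventually (Ioo_mem_nhdsGT (by norm_num : (0 : ℝ) < 1 / 2)),
    tendsto_fst.eventually (tendsto_inv_nhdsGT_zero.eventually_ge_atTop K),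
    eventually_isFrequencyBranch hg hG hiff,
    eventually_forall_mem_closedBall tendsto_snd (tendsto_fst_pow θ₀ two_ne_zero)
      (eventually_vanishes_of_agreesToFirstOrderAt (hg.of_le (by norm_num))
        (hF.of_le (by norm_num)) hG.continuousAt hiff hI),
    eventually_forall_mem_closedBall tendsto_snd (tendsto_fst_pow θ₀ two_ne_zero)
      ((continuousAt_snd.eventually (hF.eventually (by simp))).and (hΦg.eventually (by simp))),
    eventually_forall_mem_closedBall tendsto_snd (tendsto_fst_pow θ₀ three_ne_zero)
      (hassoc.eventually hbound)]
  rintro ⟨t, θ⟩ ⟨ht₀, ht₁⟩ hKt hbranch hvanish hsmooth hhess μ hμ h ⟨hh₀, hh₁⟩ s hs hμI hadj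
  have hμ₂ : μ ∈ Metric.closedBall μs (t ^ 2) :=
    Metric.ball_subset_closedBall (Metric.ball_subset_ball
      (pow_le_pow_of_le_one ht₀.le (by linarith) (by norm_num)) hμ)
  have hadj₂ : ∀ r q, μ + s r q • eDir r q ∈ Metric.closedBall μs (t ^ 2) := fun r q => by
    rw [mem_closedBall_iff_norm, add_sub_right_comm]
    calc ‖μ - μs + s r q • eDir r q‖ ≤ ‖μ - μs‖ + h := (norm_add_le _ _).trans_eq (by
          rw [norm_smul, norm_eDir, mul_one, Real.norm_eq_abs, hs])
      _ ≤ t ^ 3 + t ^ 3 := add_le_add (mem_ball_iff_norm.1 hμ).le hh₁.le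
      _ = t ^ 2 * (2 * t) := by ring
      _ ≤ t ^ 2 := mul_le_of_le_one_right (by positivity) (by linarith)
  obtain ⟨hgG, hval, hder⟩ := hvanish μ hμ₂ hμI
  obtain ⟨hw, huniq⟩ := hbranch μ hμ₂ hgG
  have hΦμ : ContDiffAt ℝ 3 (fun ν => Φ ((θ, ν), g (θ, ν))) μ :=
    (hsmooth μ hμ₂).2.comp (g := fun y => Φ (y, g y)) μ (contDiffAt_const.prodMk contDiffAt_id)
  refine ⟨_, hw, huniq, hΦμ.of_le (by norm_num), ?_⟩
  rw [← hessian_sub ((hsmooth μ hμ₂).1.of_le (by norm_num)) (hΦμ.of_le (by norm_num))]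
  refine (hhess (μ, h) ?_ hh₀ hval hder s hs fun r q hrq =>
    (hvanish _ (hadj₂ r q) (hadj r q hrq)).2.1).trans (by gcongr)
  rw [← closedBall_prod_same]
  refine ⟨Metric.ball_subset_closedBall hμ, ?_⟩
  simpa [abs_of_pos hh₀] using hh₁.le

theorem eventually_hasHessianBound [CompleteSpace Θ] {Φ : (Θ × Param d) × ℝ → ℝ}
    {F G : Param d → ℝ} {I : Θ → Set (Param d)} {θ₀ : Θ} {μs : Param d} {δ : ℝ} (hδ : δ < 0)
    (hΦ : ContDiffAt ℝ 4 Φ ((θ₀, μs), G μs)) (hF : ContDiffAt ℝ 3 F μs) (hG : ContDiffAt ℝ 1 G μs)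
    (hI : ∀ᶠ y in 𝓝 (θ₀, μs), y.2 ∈ I y.1 →
      AgreesToFirstOrderAt (fun z => Φ ((y.1, z.1), z.2)) F (y.2, G y.2)) :
    ∀ᶠ x : ℝ × Θ in 𝓝[>] 0 ×ˢ 𝓝 θ₀,
      iteratedDeriv 2 (fun ω => Φ ((x.2, μs), ω)) (G μs) ≤ δ →
      HasHessianBound (fun ν ω => Φ ((x.2, ν), ω)) F G (I x.2) μs x.1 := by
  have hΦ₁ : ContDiffAt ℝ 3 (derivSnd Φ) _ := contDiffAt_derivSnd hΦ (by norm_num)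
  have hΦ₂ : ContDiffAt ℝ 2 (derivSnd (derivSnd Φ)) _ := contDiffAt_derivSnd hΦ₁ (by norm_num)
  by_cases h₂ : derivSnd (derivSnd Φ) ((θ₀, μs), G μs) ≤ δ
  · by_cases h₁ : derivSnd Φ ((θ₀, μs), G μs) = 0
    · obtain ⟨g, hg, hg₀, hiff⟩ := exists_stationary_branch (k := 3) (by norm_num) hΦ h₁
        (h₂.trans_lt hδ).ne
      filter_upwards [eventually_hasHessianBound_of_branch (hΦ.of_le (by norm_num)) hF hG hg hg₀
        hiff hI] with x hx _ using hx
    · -- near `θ₀` there are no interpolation points, as these would be stationary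
      have hlift : Tendsto (fun y : Θ × Param d => (y, G y.2)) (𝓝 (θ₀, μs))
          (𝓝 ((θ₀, μs), G μs)) :=
        tendsto_id.prodMk_nhds (hG.continuousAt.comp (f := Prod.snd) continuousAt_snd)
      filter_upwards [eventually_forall_mem_closedBall tendsto_snd
        (tendsto_fst_pow θ₀ three_ne_zero) ((hI.and (hlift.eventually
          (hΦ₁.continuousAt.eventually_ne h₁))).and (hlift.eventually (hΦ.eventually (by simp))))]
      rintro ⟨t, θ⟩ hx - μ hμ h - s - hμI -
      obtain ⟨⟨hagree, hne⟩, hΦμ⟩ := hx μ (Metric.ball_subset_closedBall hμ)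
      exact absurd ((hasDerivAt_derivSnd (hΦμ.differentiableAt (by simp))).unique
        (hagree hμI).hasDerivAt) hne
  · have hlift : Tendsto (fun x : ℝ × Θ => ((x.2, μs), G μs)) (𝓝[>] 0 ×ˢ 𝓝 θ₀)
        (𝓝 ((θ₀, μs), G μs)) :=
      (tendsto_snd.prodMk_nhds tendsto_const_nhds).prodMk_nhds tendsto_const_nhds
    filter_upwards [hlift.eventually (hΦ₂.continuousAt.eventually_const_lt (not_le.1 h₂)),
      hlift.eventually (hΦ.eventually (by simp))] with x hx hΦx hle
    rw [iteratedDeriv_two_eq_derivSnd (z := ((x.2, μs), G μs)) (hΦx.of_le (by norm_num))] at hle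
    exact absurd hx hle.not_gt

end HessianError

section SingularValues

open Module InnerProductSpace

theorem exists_norm_sq_eq_sum_singularValues {E F : Type*} [NormedAddCommGroup E]
    [InnerProductSpace ℂ E] [FiniteDimensional ℂ E] [NormedAddCommGroup F] [InnerProductSpace ℂ F]
    [FiniteDimensional ℂ F] (T : E →ₗ[ℂ] F) : ∃ b : OrthonormalBasis (Fin (finrank ℂ E)) ℂ E,
      ∀ x, ‖T x‖ ^ 2 = ∑ i : Fin (finrank ℂ E), T.singularValues i ^ 2 * ‖b.repr x i‖ ^ 2 := by
  have hsymm := T.isSymmetric_adjoint_comp_self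
  refine ⟨hsymm.eigenvectorBasis rfl, fun x => ?_⟩
  have hterm : ∀ i, ⟪(hsymm.eigenvectorBasis rfl).repr ((LinearMap.adjoint T ∘ₗ T) x) i,
      (hsymm.eigenvectorBasis rfl).repr x i⟫_ℂ =
        ((T.singularValues i ^ 2 * ‖(hsymm.eigenvectorBasis rfl).repr x i‖ ^ 2 : ℝ) : ℂ) :=
    fun i => by
      rw [LinearMap.IsSymmetric.eigenvectorBasis_apply_self_apply, ← T.sq_singularValues_fin rfl,
        RCLike.inner_apply, map_mul, mul_comm, mul_assoc, RCLike.conj_mul]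
      simp
  refine Complex.ofReal_injective ?_
  calc ((‖T x‖ ^ 2 : ℝ) : ℂ) = ⟪(LinearMap.adjoint T ∘ₗ T) x, x⟫_ℂ := by
        rw [LinearMap.comp_apply, LinearMap.adjoint_inner_left, inner_self_eq_norm_sq_to_K]
        simp
    _ = _ := by
        rw [← (hsymm.eigenvectorBasis rfl).repr.inner_map_map, PiLp.inner_apply,
          Finset.sum_congr rfl fun i _ => hterm i, Complex.ofReal_sum]

theorem singularValues_zero_eq_opNorm {E F : Type*} [NormedAddCommGroup E]
    [InnerProductSpace ℂ E] [FiniteDimensional ℂ E] [NormedAddCommGroup F] [InnerProductSpace ℂ F]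
    [FiniteDimensional ℂ F] (T : E →ₗ[ℂ] F) :
    T.singularValues 0 = ‖LinearMap.toContinuousLinearMap T‖ := by
  obtain ⟨b, hb⟩ := exists_norm_sq_eq_sum_singularValues T
  have h₀ := T.singularValues_nonneg 0
  refine le_antisymm ?_ (ContinuousLinearMap.opNorm_le_bound _ h₀ fun x => ?_)
  · obtain hE | hE := Nat.eq_zero_or_pos (finrank ℂ E)
    · rw [T.singularValues_of_finrank_le hE.le]
      exact norm_nonneg _
    · have hval : ‖T (b ⟨0, hE⟩)‖ = T.singularValues 0 := by
        rw [← sq_eq_sq₀ (norm_nonneg _) h₀, hb, Finset.sum_eq_single ⟨0, hE⟩] <;>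
          simp +contextual
      simpa [hval] using (LinearMap.toContinuousLinearMap T).le_opNorm (b ⟨0, hE⟩)
  · rw [← sq_le_sq₀ (norm_nonneg _) (by positivity), mul_pow, ← b.repr.norm_map,
      EuclideanSpace.norm_sq_eq, Finset.mul_sum]
    refine (hb x).trans_le (Finset.sum_le_sum fun i _ => ?_)
    gcongr
    · exact T.singularValues_nonneg _
    · exact T.singularValues_antitone (Nat.zero_le _)

variable {a b : ℕ}

theorem sigmaMax_eq_norm (M : Matrix (Fin a) (Fin b) ℂ) : sigmaMax M = ‖M‖ :=
  singularValues_zero_eq_opNorm _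

theorem sigmaMin_mul_norm_le (M : Matrix (Fin a) (Fin a) ℂ) (x : EuclideanSpace ℂ (Fin a)) :
    sigmaMin M * ‖x‖ ≤ ‖Matrix.toEuclideanLin M x‖ := by
  obtain ⟨b, hb⟩ := exists_norm_sq_eq_sum_singularValues (Matrix.toEuclideanLin M)
  have h₀ : 0 ≤ sigmaMin M := LinearMap.singularValues_nonneg _ _
  rw [← sq_le_sq₀ (by positivity) (norm_nonneg _), mul_pow, hb, ← b.repr.norm_map,
    EuclideanSpace.norm_sq_eq, Finset.mul_sum]
  gcongr with i
  refine LinearMap.singularValues_antitone _ ?_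
  have := i.2.trans_eq finrank_euclideanSpace_fin
  omega

theorem det_ne_zero_of_forall_mul_norm_le {M : Matrix (Fin a) (Fin a) ℂ} {β : ℝ} (hβ : 0 < β)
    (h : ∀ x, β * ‖x‖ ≤ ‖Matrix.toEuclideanLin M x‖) : M.det ≠ 0 := fun hdet => by
  obtain ⟨v, hv, hMv⟩ := Matrix.exists_mulVec_eq_zero_iff.2 hdet
  have hle := h (WithLp.toLp 2 v)
  rw [Matrix.toLpLin_toLp, Matrix.toLin'_apply, hMv, WithLp.toLp_zero, norm_zero] at hle
  have hpos : 0 < ‖WithLp.toLp 2 v‖ := norm_pos_iff.2 (by simpa using hv)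
  exact hle.not_gt (by positivity)

theorem det_smul_one_sub_conjTranspose_mul_self (M : Matrix (Fin a) (Fin b) ℂ) (t : ℝ) :
    ((t : ℂ) • (1 : Matrix (Fin b) (Fin b) ℂ) - Mᴴ * M).det =
      ((∏ i : Fin b, (t - (Matrix.toEuclideanLin M).singularValues i ^ 2) : ℝ) : ℂ) := by
  set T := Matrix.toEuclideanLin M with hT
  have hadj : LinearMap.adjoint T ∘ₗ T = Matrix.toEuclideanLin (Mᴴ * M) := by
    rw [hT, ← Matrix.toEuclideanLin_conjTranspose_eq_adjoint]
    ext x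
    simp [Matrix.toLpLin_apply, Matrix.mulVec_mulVec]
  have hchar : (Mᴴ * M).charpoly = (LinearMap.adjoint T ∘ₗ T).charpoly := by
    rw [hadj, Matrix.toEuclideanLin_eq_toLin_orthonormal,
      ← LinearMap.charpoly_toMatrix _ (EuclideanSpace.basisFun (Fin b) ℂ).toBasis,
      LinearMap.toMatrix_toLin]
  rw [Matrix.smul_one_eq_diagonal, ← Matrix.scalar_apply, ← Matrix.eval_charpoly, hchar,
    T.isSymmetric_adjoint_comp_self.charpoly_eq (finrank_euclideanSpace_fin (n := b)),
    Polynomial.eval_prod]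
  push_cast
  refine Finset.prod_congr rfl fun i _ => ?_
  rw [Polynomial.eval_sub, Polynomial.eval_X, Polynomial.eval_C,
    ← T.sq_singularValues_fin (finrank_euclideanSpace_fin (n := b))]
  simp

end SingularValues

section MatrixSmoothness

variable {X : Type*} [NormedAddCommGroup X] [NormedSpace ℝ X] {a b c : ℕ} {k : WithTop ℕ∞} {x : X}

theorem contDiffAt_matrix_iff {M : X → Matrix (Fin a) (Fin b) ℂ} :
    ContDiffAt ℝ k M x ↔ ∀ i j, ContDiffAt ℝ k (fun y => M y i j) x := by
  let L : Matrix (Fin a) (Fin b) ℂ ≃L[ℝ] (Fin a → Fin b → ℂ) :=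
    (LinearEquiv.refl ℝ (Matrix (Fin a) (Fin b) ℂ)).toContinuousLinearEquiv
  rw [← L.comp_contDiffAt_iff]
  exact contDiffAt_pi.trans (forall_congr' fun i => contDiffAt_pi)

theorem contDiffAt_matrix_mul {M : X → Matrix (Fin a) (Fin b) ℂ} {N : X → Matrix (Fin b) (Fin c) ℂ}
    (hM : ContDiffAt ℝ k M x) (hN : ContDiffAt ℝ k N x) :
    ContDiffAt ℝ k (fun y => M y * N y) x := by
  rw [contDiffAt_matrix_iff] at *
  simp only [Matrix.mul_apply]
  exact fun i j => ContDiffAt.sum fun l _ => (hM i l).mul (hN l j)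

theorem contDiffAt_matrix_conjTranspose {M : X → Matrix (Fin a) (Fin b) ℂ}
    (hM : ContDiffAt ℝ k M x) : ContDiffAt ℝ k (fun y => (M y)ᴴ) x := by
  rw [contDiffAt_matrix_iff] at *
  exact fun i j => Complex.conjCLE.contDiff.contDiffAt.comp x (hM j i)

theorem contDiffAt_matrix_det {M : X → Matrix (Fin a) (Fin a) ℂ} (hM : ContDiffAt ℝ k M x) :
    ContDiffAt ℝ k (fun y => (M y).det) x := by
  rw [contDiffAt_matrix_iff] at hM
  simp only [Matrix.det_apply]
  exact ContDiffAt.sum fun σ _ => (contDiffAt_prod fun i _ => hM _ _).const_smul _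

theorem contDiffAt_matrix_inv {M : X → Matrix (Fin a) (Fin a) ℂ} (hM : ContDiffAt ℝ k M x)
    (hdet : (M x).det ≠ 0) : ContDiffAt ℝ k (fun y => (M y)⁻¹) x := by
  have : CompleteSpace (Matrix (Fin a) (Fin a) ℂ) := FiniteDimensional.complete ℂ _
  obtain ⟨u, hu⟩ := (Matrix.isUnit_iff_isUnit_det _).2 hdet.isUnit
  simp only [Matrix.nonsing_inv_eq_ringInverse]
  exact (hu ▸ contDiffAt_ringInverse ℝ u : ContDiffAt ℝ k Ring.inverse (M x)).comp x hM

/-- The characteristic polynomial of `Mᴴ * M` evaluated at `t`, as a function of `(M, t)`; its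
roots are the squares of the singular values of `M`. -/
noncomputable def gramCharpoly (y : Matrix (Fin a) (Fin b) ℂ × ℝ) : ℝ :=
  (((y.2 : ℂ) • (1 : Matrix (Fin b) (Fin b) ℂ) - y.1ᴴ * y.1).det).re

theorem gramCharpoly_eq_prod (M : Matrix (Fin a) (Fin b) ℂ) (t : ℝ) :
    gramCharpoly (M, t) = ∏ i : Fin b, (t - (Matrix.toEuclideanLin M).singularValues i ^ 2) := by
  rw [gramCharpoly, det_smul_one_sub_conjTranspose_mul_self, Complex.ofReal_re]

theorem gramCharpoly_eq_mul_prod (M : Matrix (Fin a) (Fin (b + 1)) ℂ) (t : ℝ) :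
    gramCharpoly (M, t) = (t - ‖M‖ ^ 2) *
      ∏ i : Fin b, (t - (Matrix.toEuclideanLin M).singularValues (i + 1) ^ 2) := by
  rw [gramCharpoly_eq_prod, Fin.prod_univ_succ, ← sigmaMax_eq_norm]
  rfl

theorem contDiff_gramCharpoly :
    ContDiff ℝ k (gramCharpoly : Matrix (Fin a) (Fin b) ℂ × ℝ → ℝ) := by
  refine Complex.reCLM.contDiff.comp (contDiff_iff_contDiffAt.2 fun y => contDiffAt_matrix_det ?_)
  exact ((Complex.ofRealCLM.contDiff.contDiffAt.comp y contDiffAt_snd).smul contDiffAt_const).sub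
    (contDiffAt_matrix_mul (contDiffAt_matrix_conjTranspose contDiffAt_fst) contDiffAt_fst)

theorem derivSnd_gramCharpoly (M : Matrix (Fin a) (Fin (b + 1)) ℂ) :
    derivSnd gramCharpoly (M, ‖M‖ ^ 2) =
      ∏ i : Fin b, (‖M‖ ^ 2 - (Matrix.toEuclideanLin M).singularValues (i + 1) ^ 2) := by
  have hP : DifferentiableAt ℝ (fun t : ℝ =>
      ∏ i : Fin b, (t - (Matrix.toEuclideanLin M).singularValues (i + 1) ^ 2)) (‖M‖ ^ 2) := by
    fun_prop
  have hderiv := hasDerivAt_derivSnd (contDiff_gramCharpoly.differentiable one_ne_zero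
    ((M, ‖M‖ ^ 2) : Matrix (Fin a) (Fin (b + 1)) ℂ × ℝ))
  simp only [gramCharpoly_eq_mul_prod] at hderiv
  rw [hderiv.unique (((hasDerivAt_id' (‖M‖ ^ 2)).sub_const (‖M‖ ^ 2)).fun_mul hP.hasDerivAt),
    one_mul, sub_self, zero_mul, add_zero]

theorem derivSnd_gramCharpoly_ne_zero {M : Matrix (Fin a) (Fin (b + 1)) ℂ}
    (hsimple : sigmaSecond M < ‖M‖) : derivSnd gramCharpoly (M, ‖M‖ ^ 2) ≠ 0 := by
  rw [derivSnd_gramCharpoly]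
  refine Finset.prod_ne_zero_iff.2 fun i _ => (sub_pos.2 ?_).ne'
  have hle : (Matrix.toEuclideanLin M).singularValues (i + 1) ≤ sigmaSecond M :=
    LinearMap.singularValues_antitone _ (Nat.le_add_left 1 i)
  exact pow_lt_pow_left₀ (hle.trans_lt hsimple) (LinearMap.singularValues_nonneg _ _) two_ne_zero

theorem contDiffAt_norm_of_simple {M₀ : Matrix (Fin a) (Fin b) ℂ} (hpos : 0 < ‖M₀‖)
    (hsimple : sigmaSecond M₀ < ‖M₀‖) (hk : k ≠ 0) :
    ContDiffAt ℝ k (fun M : Matrix (Fin a) (Fin b) ℂ => ‖M‖) M₀ := by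
  cases b with
  | zero => exact absurd (norm_pos_iff.1 hpos) (not_not.2 (Subsingleton.elim _ _))
  | succ b =>
    have : CompleteSpace (Matrix (Fin a) (Fin (b + 1)) ℂ) := FiniteDimensional.complete ℂ _
    have hroot : ∀ M : Matrix (Fin a) (Fin (b + 1)) ℂ, gramCharpoly (M, ‖M‖ ^ 2) = 0 := fun M => by
      rw [gramCharpoly_eq_mul_prod, sub_self, zero_mul]
    obtain ⟨g, hg, hg₀, hiff⟩ := exists_implicit_scalar hk contDiff_gramCharpoly.contDiffAt
      (hroot M₀) (derivSnd_gramCharpoly_ne_zero hsimple)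
    have hlim : Tendsto (fun M : Matrix (Fin a) (Fin (b + 1)) ℂ => (M, ‖M‖ ^ 2)) (𝓝 M₀)
        (𝓝 (M₀, ‖M₀‖ ^ 2)) := Continuous.tendsto' (by fun_prop) _ _ rfl
    refine (hg.sqrt (hg₀ ▸ (pow_pos hpos 2).ne')).congr_of_eventuallyEq ?_
    filter_upwards [hlim.eventually hiff] with M hM
    rw [hM.1 (hroot M), Real.sqrt_sq (norm_nonneg M)]

end MatrixSmoothness

section RationalFunctions

theorem ratFunc_eval_eq_div {K : Type*} [Field K] (q : RatFunc K) (s : K) :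
    RatFunc.eval (RingHom.id K) s q = q.num.eval s / q.denom.eval s := by
  rw [RatFunc.eval, Polynomial.eval₂_id, Polynomial.eval₂_id]

theorem ratFunc_eval_div {K : Type*} [Field K] {p q : Polynomial K} {s : K} (h : q.eval s ≠ 0) :
    RatFunc.eval (RingHom.id K) s (algebraMap _ (RatFunc K) p / algebraMap _ (RatFunc K) q) =
      p.eval s / q.eval s := by
  set x := algebraMap (Polynomial K) (RatFunc K) p / algebraMap _ (RatFunc K) q with hx
  have hq : q ≠ 0 := fun hq => h (by simp [hq])
  have hcross : x.num * q = p * x.denom := (RatFunc.num_mul_eq_mul_denom_iff hq).2 hx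
  have hdenom : x.denom.eval s ≠ 0 := by
    obtain ⟨c, hc⟩ := RatFunc.denom_div_dvd p q
    rw [hc, Polynomial.eval_mul] at h
    exact left_ne_zero_of_mul h
  rw [ratFunc_eval_eq_div, div_eq_div_iff hdenom h]
  simpa only [Polynomial.eval_mul] using congrArg (Polynomial.eval s) hcross

theorem ratFunc_denom_eval_ne_zero_of_bounded {q : RatFunc ℂ} {K : ℝ}
    (hK : ∀ s : ℂ, 0 < s.re → ‖RatFunc.eval (RingHom.id ℂ) s q‖ ≤ K) {s : ℂ} (hs : 0 ≤ s.re) :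
    q.denom.eval s ≠ 0 := fun hdenom => by
  have hnum : q.num.eval s ≠ 0 := fun hnum => by
    obtain ⟨a, b, hab⟩ := RatFunc.isCoprime_num_denom q
    simpa [hdenom, hnum] using congrArg (Polynomial.eval s) hab
  have hray : Tendsto (fun t : ℝ => s + t) (𝓝[>] 0) (𝓝[≠] s) := by
    refine tendsto_nhdsWithin_iff.2 ⟨(Continuous.tendsto' (by fun_prop) _ _ (by simp)).mono_left
      nhdsWithin_le_nhds, ?_⟩
    filter_upwards [self_mem_nhdsWithin] with t ht
    simpa using (mem_Ioi.1 ht).ne'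
  have hev : ∀ᶠ z in 𝓝[≠] s, q.denom.eval z ≠ 0 :=
    nhdsNE_le_cofinite s
      (Polynomial.finite_setOfPred_isRoot (RatFunc.denom_ne_zero q)).compl_mem_cofinite
  have hle : ∀ᶠ t : ℝ in 𝓝[>] 0, ‖q.num.eval (s + t)‖ ≤ K * ‖q.denom.eval (s + t)‖ := by
    filter_upwards [hray.eventually hev, self_mem_nhdsWithin] with t ht ht₀
    have := hK (s + t) (by simpa using add_pos_of_nonneg_of_pos hs ht₀)
    rwa [ratFunc_eval_eq_div, norm_div, div_le_iff₀ (norm_pos_iff.2 ht)] at this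
  have hlim : ∀ P : Polynomial ℂ, Tendsto (fun t : ℝ => ‖P.eval (s + t)‖) (𝓝[>] 0)
      (𝓝 ‖P.eval s‖) := fun P =>
    (P.continuous.norm.tendsto s).comp (hray.mono_right nhdsWithin_le_nhds)
  have hzero := le_of_tendsto_of_tendsto (hlim q.num) ((hlim q.denom).const_mul K) hle
  rw [hdenom, norm_zero, mul_zero] at hzero
  exact hnum (norm_le_zero_iff.1 hzero)

end RationalFunctions

section EntrywiseBounds

theorem norm_entry_le {a b : ℕ} (M : Matrix (Fin a) (Fin b) ℂ) (i : Fin a) (j : Fin b) :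
    ‖M i j‖ ≤ ‖M‖ := by
  have h := (PiLp.norm_apply_le (WithLp.toLp 2 (M *ᵥ EuclideanSpace.single j (1 : ℂ))) i).trans
    (M.l2_opNorm_mulVec (EuclideanSpace.single j 1))
  simpa using h

theorem differentiableAt_matrix {a b : ℕ} {M : ℂ → Matrix (Fin a) (Fin b) ℂ} {s : ℂ}
    (h : ∀ i j, DifferentiableAt ℂ (fun z => M z i j) s) : DifferentiableAt ℂ M s := by
  let L : Matrix (Fin a) (Fin b) ℂ ≃L[ℂ] (Fin a → Fin b → ℂ) :=
    (LinearEquiv.refl ℂ (Matrix (Fin a) (Fin b) ℂ)).toContinuousLinearEquiv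
  rw [← L.comp_differentiableAt_iff]
  exact differentiableAt_pi.2 fun i => differentiableAt_pi.2 fun j => h i j

end EntrywiseBounds

namespace Descriptor

variable {r m p : ℕ} (P : Descriptor r m p)

theorem sigma_eq_norm (ω : ℝ) : P.sigma ω = ‖P.H (Complex.I * ω)‖ := sigmaMax_eq_norm _

/-- The pencil `s E - A` as a matrix of polynomials in `s`. -/
noncomputable def polyPencil : Matrix (Fin r) (Fin r) (Polynomial ℂ) :=
  (Polynomial.X : Polynomial ℂ) • P.E.map Polynomial.C - P.A.map Polynomial.C

theorem mapMatrix_eval_polyPencil (s : ℂ) :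
    (Polynomial.evalRingHom s).mapMatrix P.polyPencil = P.D s := by
  ext i j
  simpa [polyPencil, D] using mul_comm _ _

theorem transfer_eq_inv_det_smul : P.transfer =
    (algebraMap (Polynomial ℂ) (RatFunc ℂ) P.polyPencil.det)⁻¹ •
      (P.C.map Polynomial.C * P.polyPencil.adjugate * P.B.map Polynomial.C).map
        (algebraMap (Polynomial ℂ) (RatFunc ℂ)) := by
  have hpencil : (RatFunc.X : RatFunc ℂ) • P.E.map RatFunc.C - P.A.map RatFunc.C =
      (algebraMap (Polynomial ℂ) (RatFunc ℂ)).mapMatrix P.polyPencil := by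
    ext i j
    simpa [polyPencil] using mul_comm _ _
  unfold transfer
  rw [hpencil, Matrix.inv_def, ← RingHom.map_det, ← RingHom.map_adjugate, Ring.inverse_eq_inv',
    Matrix.map_mul, Matrix.map_mul, Matrix.map_map, Matrix.map_map, Matrix.mul_smul,
    Matrix.smul_mul]
  rfl

theorem H_eq_of_det_ne_zero {s : ℂ} (h : (P.D s).det ≠ 0) :
    P.H s = P.C * (P.D s)⁻¹ * P.B := by
  set Q := P.C.map Polynomial.C * P.polyPencil.adjugate * P.B.map Polynomial.C with hQ
  have hdet : P.polyPencil.det.eval s = (P.D s).det := by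
    rw [← mapMatrix_eval_polyPencil, ← RingHom.map_det, Polynomial.coe_evalRingHom]
  have hadj : P.polyPencil.adjugate.map (Polynomial.evalRingHom s) = (P.D s).adjugate := by
    rw [← mapMatrix_eval_polyPencil, ← RingHom.map_adjugate, RingHom.mapMatrix_apply]
  have hC : ∀ {a b : ℕ} (M : Matrix (Fin a) (Fin b) ℂ),
      (M.map Polynomial.C).map (Polynomial.evalRingHom s) = M := fun M => by ext; simp
  have hQs : Q.map (Polynomial.evalRingHom s) = P.C * (P.D s).adjugate * P.B := by
    rw [hQ, Matrix.map_mul, Matrix.map_mul, hadj, hC, hC]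
  ext i j
  calc P.H s i j = (Q i j).eval s / P.polyPencil.det.eval s := by
        rw [← ratFunc_eval_div (hdet ▸ h), div_eq_inv_mul, H, transfer_eq_inv_det_smul]
        rfl
    _ = (P.C * (P.D s)⁻¹ * P.B) i j := by
        rw [hdet, Matrix.inv_def, Matrix.mul_smul, Matrix.smul_mul, ← hQs, Ring.inverse_eq_inv',
          Matrix.smul_apply, smul_eq_mul, div_eq_inv_mul]
        rfl

variable {P}

theorem IsHinf.differentiableAt (hP : P.IsHinf) {s : ℂ} (hs : 0 ≤ s.re) :
    DifferentiableAt ℂ P.H s := by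
  obtain ⟨K, hK⟩ := hP.2
  refine differentiableAt_matrix fun i j => ?_
  have hdenom : (P.transfer i j).denom.eval s ≠ 0 :=
    ratFunc_denom_eval_ne_zero_of_bounded
      (fun z hz => (norm_entry_le (P.H z) i j).trans (hK ⟨⟨z, hz⟩, rfl⟩)) hs
  simp only [H, Matrix.map_apply, ratFunc_eval_eq_div]
  exact (Polynomial.differentiableAt _).div (Polynomial.differentiableAt _) hdenom

theorem IsHinf.sigma_le_hinfNorm (hP : P.IsHinf) (ω : ℝ) : P.sigma ω ≤ P.hinfNorm := by
  have hline : Tendsto (fun t : ℝ => Complex.I * ω + t) (𝓝[>] 0) (𝓝 (Complex.I * ω)) :=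
    (Continuous.tendsto' (by fun_prop) _ _ (by simp)).mono_left nhdsWithin_le_nhds
  have hcont : ContinuousAt P.H (Complex.I * ω) := (hP.differentiableAt (by simp)).continuousAt
  rw [sigma_eq_norm]
  refine le_of_tendsto (hcont.norm.tendsto.comp hline) ?_
  filter_upwards [self_mem_nhdsWithin] with t ht
  exact le_ciSup hP.2 ⟨Complex.I * ω + t, by simpa using ht⟩

theorem IsHinf.hinfNorm_le (hP : P.IsHinf) {c : ℝ} (hc : ∀ ω : ℝ, P.sigma ω ≤ c) :
    P.hinfNorm ≤ c := by
  obtain ⟨K, hK⟩ := hP.2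
  have : Nonempty {s : ℂ // 0 < s.re} := ⟨⟨1, by simp⟩⟩
  refine ciSup_le fun s => PhragmenLindelof.right_half_plane_of_bounded_on_real (f := P.H) ?_
    ⟨0, by norm_num, 0, Asymptotics.IsBigO.of_bound K ?_⟩ ⟨K, ?_⟩ (fun ω => ?_) s.2.le
  · refine DifferentiableOn.diffContOnCl fun z hz => ?_
    rw [Complex.closure_setOfPred_lt_re] at hz
    exact (hP.differentiableAt hz).differentiableWithinAt
  · refine (eventually_principal.2 fun z hz => ?_).filter_mono inf_le_right
    simpa using hK ⟨⟨z, hz⟩, rfl⟩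
  · rw [eventually_map]
    filter_upwards [eventually_gt_atTop 0] with x hx
    exact hK ⟨⟨(x : ℂ), by simpa using hx⟩, rfl⟩
  · rw [mul_comm, ← sigma_eq_norm]
    exact hc ω

theorem IsHinf.hinfNorm_eq (hP : P.IsHinf) {ω₀ : ℝ} (hmax : ∀ ω : ℝ, P.sigma ω ≤ P.sigma ω₀) :
    P.hinfNorm = P.sigma ω₀ :=
  (hP.hinfNorm_le hmax).antisymm (hP.sigma_le_hinfNorm ω₀)

end Descriptor

section NormDerivative

theorem fderiv_norm_eq_zero_of_norm_add_smul_sq_le {F : Type*} [NormedAddCommGroup F]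
    [NormedSpace ℝ F] {x v : F} {K : ℝ} (hx : x ≠ 0) (hn : DifferentiableAt ℝ (‖·‖) x)
    (h : ∀ t : ℝ, ‖x + t • v‖ ^ 2 ≤ ‖x‖ ^ 2 + t ^ 2 * K) : fderiv ℝ (‖·‖) x v = 0 := by
  have hline : HasDerivAt (fun t : ℝ => x + t • v) v 0 := by
    simpa using ((hasDerivAt_id (0 : ℝ)).smul_const v).const_add x
  have hnorm : HasDerivAt (fun t : ℝ => ‖x + t • v‖) (fderiv ℝ (‖·‖) x v) 0 :=
    HasFDerivAt.comp_hasDerivAt (0 : ℝ) (by simpa using hn.hasFDerivAt) hline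
  have hgap := (hnorm.pow 2).sub (((hasDerivAt_id (0 : ℝ)).pow 2).mul_const K)
  have hmax : IsLocalMax (fun t : ℝ => ‖x + t • v‖ ^ 2 - t ^ 2 * K) 0 :=
    Eventually.of_forall fun t => by simpa [add_comm] using h t
  simpa [hx] using hmax.hasDerivAt_eq_zero hgap

variable {a b c : ℕ} {M Δ : Matrix (Fin a) (Fin b) ℂ}

theorem fderiv_norm_eq_zero_of_conjTranspose_mul_eq_zero (hM : M ≠ 0)
    (hn : DifferentiableAt ℝ (‖·‖) M) (h : Mᴴ * Δ = 0) : fderiv ℝ (‖·‖) M Δ = 0 := by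
  refine fderiv_norm_eq_zero_of_norm_add_smul_sq_le (K := ‖Δᴴ * Δ‖) hM hn fun t => ?_
  have h' : Δᴴ * M = 0 := by simpa using congrArg Matrix.conjTranspose h
  have hsq : (M + t • Δ)ᴴ * (M + t • Δ) = Mᴴ * M + t ^ 2 • (Δᴴ * Δ) := by
    simp [Matrix.add_mul, Matrix.mul_add, h, h', smul_smul, sq]
  rw [sq, sq ‖M‖, ← Matrix.l2_opNorm_conjTranspose_mul_self,
    ← Matrix.l2_opNorm_conjTranspose_mul_self, hsq]
  exact (norm_add_le _ _).trans_eq (by rw [norm_smul, norm_pow, Real.norm_eq_abs, sq_abs])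

theorem fderiv_norm_eq_zero_of_mul_conjTranspose_eq_zero (hM : M ≠ 0)
    (hn : DifferentiableAt ℝ (‖·‖) M) (h : Δ * Mᴴ = 0) : fderiv ℝ (‖·‖) M Δ = 0 := by
  refine fderiv_norm_eq_zero_of_norm_add_smul_sq_le (K := ‖Δ * Δᴴ‖) hM hn fun t => ?_
  have h' : M * Δᴴ = 0 := by simpa using congrArg Matrix.conjTranspose h
  have hnorm : ∀ N : Matrix (Fin a) (Fin b) ℂ, ‖N‖ ^ 2 = ‖N * Nᴴ‖ := fun N => by
    rw [sq, ← Matrix.l2_opNorm_conjTranspose N, ← Matrix.l2_opNorm_conjTranspose_mul_self,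
      Matrix.conjTranspose_conjTranspose]
  have hsq : (M + t • Δ) * (M + t • Δ)ᴴ = M * Mᴴ + t ^ 2 • (Δ * Δᴴ) := by
    simp [Matrix.add_mul, Matrix.mul_add, h, h', smul_smul, sq]
  rw [hnorm, hnorm M, hsq]
  exact (norm_add_le _ _).trans_eq (by rw [norm_smul, norm_pow, Real.norm_eq_abs, sq_abs])

variable {X : Type*} [NormedAddCommGroup X] [NormedSpace ℝ X] {x₀ : X}

theorem hasFDerivAt_zero_matrix_mul {A : X → Matrix (Fin a) (Fin b) ℂ}
    {R : X → Matrix (Fin b) (Fin c) ℂ} (hA : DifferentiableAt ℝ A x₀) (hR : ContinuousAt R x₀)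
    (hA₀ : A x₀ = 0) (hR₀ : R x₀ = 0) :
    HasFDerivAt (fun x => A x * R x) (0 : X →L[ℝ] Matrix (Fin a) (Fin c) ℂ) x₀ := by
  have hbig : A =O[𝓝 x₀] fun x => x - x₀ := by simpa [hA₀] using hA.isBigO_sub
  have hlittle : R =o[𝓝 x₀] fun _ => (1 : ℝ) := by
    rw [Asymptotics.isLittleO_one_iff, ← hR₀]
    exact hR
  have hprod : (fun x => ‖A x‖ * ‖R x‖) =o[𝓝 x₀] fun x => x - x₀ := by
    have := hbig.norm_norm.mul_isLittleO hlittle.norm_left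
    simp only [mul_one] at this
    exact this.of_norm_right
  rw [hasFDerivAt_iff_isLittleO]
  refine Asymptotics.IsBigO.trans_isLittleO (.of_bound 1 (.of_forall fun x => ?_)) hprod
  simpa [hA₀] using Matrix.l2_opNorm_mul (A x) (R x)

variable {M N : X → Matrix (Fin a) (Fin b) ℂ}

theorem fderiv_norm_comp_eq (hM : DifferentiableAt ℝ M x₀) (hN : DifferentiableAt ℝ N x₀)
    (h₀ : N x₀ = M x₀) (hn : DifferentiableAt ℝ (‖·‖) (M x₀))
    (h : ∀ v, fderiv ℝ (‖·‖) (M x₀) (fderiv ℝ (fun x => M x - N x) x₀ v) = 0) :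
    fderiv ℝ (fun x => ‖N x‖) x₀ = fderiv ℝ (fun x => ‖M x‖) x₀ := by
  have hM' : HasFDerivAt (fun x => ‖M x‖) _ x₀ := hn.hasFDerivAt.comp x₀ hM.hasFDerivAt
  have hN' : HasFDerivAt (fun x => ‖N x‖) _ x₀ := (h₀ ▸ hn).hasFDerivAt.comp x₀ hN.hasFDerivAt
  rw [hM'.fderiv, hN'.fderiv, h₀]
  ext v
  have hv := h v
  rw [fderiv_fun_sub hM hN, _root_.sub_apply, map_sub, sub_eq_zero] at hv
  exact hv.symm

theorem fderiv_norm_comp_eq_of_conjTranspose_mul (hM : DifferentiableAt ℝ M x₀)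
    (hN : DifferentiableAt ℝ N x₀) (h₀ : N x₀ = M x₀) (hn : DifferentiableAt ℝ (‖·‖) (M x₀))
    (hpos : M x₀ ≠ 0)
    (h : HasFDerivAt (fun x => (M x₀)ᴴ * (M x - N x)) (0 : X →L[ℝ] Matrix (Fin b) (Fin b) ℂ) x₀) :
    fderiv ℝ (fun x => ‖N x‖) x₀ = fderiv ℝ (fun x => ‖M x‖) x₀ := by
  refine fderiv_norm_comp_eq hM hN h₀ hn fun v =>
    fderiv_norm_eq_zero_of_conjTranspose_mul_eq_zero hpos hn ?_
  let L := (mulLeftLinearMap (Fin b) ℝ (M x₀)ᴴ).toContinuousLinearMap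
  exact congrArg (· v) ((L.hasFDerivAt.comp x₀ (hM.sub hN).hasFDerivAt).unique h)

theorem fderiv_norm_comp_eq_of_mul_conjTranspose (hM : DifferentiableAt ℝ M x₀)
    (hN : DifferentiableAt ℝ N x₀) (h₀ : N x₀ = M x₀) (hn : DifferentiableAt ℝ (‖·‖) (M x₀))
    (hpos : M x₀ ≠ 0)
    (h : HasFDerivAt (fun x => (M x - N x) * (M x₀)ᴴ) (0 : X →L[ℝ] Matrix (Fin a) (Fin a) ℂ) x₀) :
    fderiv ℝ (fun x => ‖N x‖) x₀ = fderiv ℝ (fun x => ‖M x‖) x₀ := by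
  refine fderiv_norm_comp_eq hM hN h₀ hn fun v =>
    fderiv_norm_eq_zero_of_mul_conjTranspose_eq_zero hpos hn ?_
  let L := (mulRightLinearMap (Fin a) ℝ (M x₀)ᴴ).toContinuousLinearMap
  exact congrArg (· v) ((L.hasFDerivAt.comp x₀ (hM.sub hN).hasFDerivAt).unique h)

end NormDerivative

section PetrovGalerkin

variable {a b n r : ℕ}

/-- The error `D⁻¹ - V (W^* D V)⁻¹ W^*` of the Petrov-Galerkin approximation of `D⁻¹` with trial
space spanned by `V` and test space spanned by `W`. -/
noncomputable def invError (D : Matrix (Fin n) (Fin n) ℂ) (V W : Matrix (Fin n) (Fin r) ℂ) :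
    Matrix (Fin n) (Fin n) ℂ :=
  D⁻¹ - V * (Wᴴ * D * V)⁻¹ * Wᴴ

variable {D : Matrix (Fin n) (Fin n) ℂ} {V W : Matrix (Fin n) (Fin r) ℂ}

theorem invError_mul_mul (hdet : D.det ≠ 0) (hred : (Wᴴ * D * V).det ≠ 0) :
    invError D V W * (D * V) = 0 := by
  rw [invError, Matrix.sub_mul, Matrix.nonsing_inv_mul_cancel_left _ _ hdet.isUnit,
    Matrix.mul_assoc (V * _), ← Matrix.mul_assoc Wᴴ, Matrix.mul_assoc V,
    Matrix.nonsing_inv_mul _ hred.isUnit, Matrix.mul_one, sub_self]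

theorem mul_mul_invError (hdet : D.det ≠ 0) (hred : (Wᴴ * D * V).det ≠ 0) :
    Wᴴ * D * invError D V W = 0 := by
  rw [invError, Matrix.mul_sub, Matrix.mul_nonsing_inv_cancel_right _ _ hdet.isUnit,
    ← Matrix.mul_assoc, ← Matrix.mul_assoc, Matrix.mul_nonsing_inv _ hred.isUnit, Matrix.one_mul,
    sub_self]

theorem exists_mul_eq_of_colSpace_le {M : Matrix (Fin n) (Fin a) ℂ}
    (h : colSpace M ≤ colSpace V) : ∃ Y : Matrix (Fin r) (Fin a) ℂ, V * Y = M := by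
  have hcol : ∀ j, ∃ y : Fin r → ℂ, V *ᵥ y = M.col j := fun j =>
    h ⟨Pi.single j 1, Matrix.mulVec_single_one M j⟩
  choose y hy using hcol
  exact ⟨Matrix.of fun i j => y j i, Matrix.ext fun i j => congrFun (hy j) i⟩

theorem exists_eq_mul_mul_of_colSpace_le {L : Matrix (Fin n) (Fin a) ℂ} (hdet : D.det ≠ 0)
    (h : colSpace (D⁻¹ * L) ≤ colSpace V) : ∃ Y : Matrix (Fin r) (Fin a) ℂ, L = D * V * Y := by
  obtain ⟨Y, hY⟩ := exists_mul_eq_of_colSpace_le h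
  exact ⟨Y, by rw [Matrix.mul_assoc, hY, Matrix.mul_nonsing_inv_cancel_left _ _ hdet.isUnit]⟩

theorem exists_eq_mul_conjTranspose_mul_of_colSpace_le {K : Matrix (Fin b) (Fin n) ℂ}
    (hdet : D.det ≠ 0) (h : colSpace ((D⁻¹)ᴴ * Kᴴ) ≤ colSpace W) :
    ∃ Z : Matrix (Fin b) (Fin r) ℂ, K = Z * (Wᴴ * D) := by
  rw [Matrix.conjTranspose_nonsing_inv] at h
  obtain ⟨Z, hZ⟩ := exists_eq_mul_mul_of_colSpace_le (by simpa using hdet) h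
  exact ⟨Zᴴ, by simpa using congrArg Matrix.conjTranspose hZ⟩

variable {X : Type*} [NormedAddCommGroup X] [NormedSpace ℝ X] {x₀ : X}

theorem contDiffAt_invError {k : WithTop ℕ∞} {D : X → Matrix (Fin n) (Fin n) ℂ}
    (hD : ContDiffAt ℝ k D x₀) (hdet : (D x₀).det ≠ 0) (hred : (Wᴴ * D x₀ * V).det ≠ 0) :
    ContDiffAt ℝ k (fun x => invError (D x) V W) x₀ :=
  (contDiffAt_matrix_inv hD hdet).sub (contDiffAt_matrix_mul (contDiffAt_matrix_mul
    contDiffAt_const (contDiffAt_matrix_inv (contDiffAt_matrix_mul (contDiffAt_matrix_mul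
    contDiffAt_const hD) contDiffAt_const) hred)) contDiffAt_const)

theorem hasFDerivAt_zero_mul_invError_mul {D : X → Matrix (Fin n) (Fin n) ℂ}
    {K : X → Matrix (Fin b) (Fin n) ℂ} {L : X → Matrix (Fin n) (Fin a) ℂ}
    (hD : ContDiffAt ℝ 1 D x₀) (hK : ContDiffAt ℝ 1 K x₀) (hL : ContDiffAt ℝ 1 L x₀)
    (hdet : (D x₀).det ≠ 0) (hred : (Wᴴ * D x₀ * V).det ≠ 0)
    (hV : colSpace ((D x₀)⁻¹ * L x₀) ≤ colSpace V)
    (hW : colSpace (((D x₀)⁻¹)ᴴ * (K x₀)ᴴ) ≤ colSpace W) :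
    HasFDerivAt (fun x => K x * invError (D x) V W * L x)
      (0 : X →L[ℝ] Matrix (Fin b) (Fin a) ℂ) x₀ := by
  obtain ⟨Y, hY⟩ := exists_eq_mul_mul_of_colSpace_le hdet hV
  obtain ⟨Z, hZ⟩ := exists_eq_mul_conjTranspose_mul_of_colSpace_le hdet hW
  have hleft : ContDiffAt ℝ 1 (fun x => K x - Z * (Wᴴ * D x)) x₀ := hK.sub
    (contDiffAt_matrix_mul contDiffAt_const (contDiffAt_matrix_mul contDiffAt_const hD))
  have hright : ContDiffAt ℝ 1 (fun x => L x - D x * V * Y) x₀ := hL.sub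
    (contDiffAt_matrix_mul (contDiffAt_matrix_mul hD contDiffAt_const) contDiffAt_const)
  have hmid := contDiffAt_matrix_mul (contDiffAt_invError hD hdet hred) hright
  have hWDV := contDiffAt_matrix_mul (contDiffAt_matrix_mul (contDiffAt_const (c := Wᴴ)) hD)
    (contDiffAt_const (c := V))
  refine (hasFDerivAt_zero_matrix_mul (hleft.differentiableAt one_ne_zero) hmid.continuousAt
    (sub_eq_zero.2 hZ) (by simp [← hY])).congr_of_eventuallyEq ?_
  filter_upwards [(contDiffAt_matrix_det hD).continuousAt.eventually_ne hdet,
    (contDiffAt_matrix_det hWDV).continuousAt.eventually_ne hred] with x hx hx'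
  rw [Matrix.mul_sub _ (L x), ← Matrix.mul_assoc _ (D x * V), invError_mul_mul hx hx',
    Matrix.zero_mul, sub_zero, Matrix.sub_mul, Matrix.mul_assoc Z, ← Matrix.mul_assoc (Wᴴ * D x),
    mul_mul_invError hx hx', Matrix.zero_mul, Matrix.mul_zero, sub_zero, Matrix.mul_assoc]

end PetrovGalerkin

namespace Descriptor

variable {n r m p : ℕ}

/-- The Petrov-Galerkin reduction of a system with trial basis `V` and test basis `W`. -/
def reduce (P : Descriptor n m p) (V W : Matrix (Fin n) (Fin r) ℂ) : Descriptor r m p where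
  E := Wᴴ * P.E * V
  A := Wᴴ * P.A * V
  B := Wᴴ * P.B
  C := P.C * V

theorem reduce_D (P : Descriptor n m p) (V W : Matrix (Fin n) (Fin r) ℂ) (s : ℂ) :
    (P.reduce V W).D s = Wᴴ * P.D s * V := by
  simp [reduce, D, Matrix.mul_sub, Matrix.sub_mul]

/-- The column spaces of `V` and `W` contain the spaces by which an expansion at the frequency `ω`
enlarges the reduction subspaces. -/
def InterpolatedBy (P : Descriptor n m p) (V W : Matrix (Fin n) (Fin r) ℂ) (ω : ℝ) : Prop :=
  P.expandV ω ≤ colSpace V ∧ P.expandW ω ≤ colSpace W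

theorem H_sub_H_reduce {P : Descriptor n m p} {V W : Matrix (Fin n) (Fin r) ℂ} {s : ℂ}
    (hdet : (P.D s).det ≠ 0) (hred : ((P.reduce V W).D s).det ≠ 0) :
    P.H s - (P.reduce V W).H s = P.C * invError (P.D s) V W * P.B := by
  rw [H_eq_of_det_ne_zero P hdet, H_eq_of_det_ne_zero _ hred, reduce_D, invError, Matrix.mul_sub,
    Matrix.sub_mul]
  simp only [reduce, Matrix.mul_assoc]

section Smooth

variable {X : Type*} [NormedAddCommGroup X] [NormedSpace ℝ X] {k : WithTop ℕ∞} {x₀ : X}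

/-- The coefficient matrices of the system `P x` depend on `x` in a `C^k` manner at `x₀`. -/
structure ContDiffFamilyAt (k : WithTop ℕ∞) (P : X → Descriptor r m p) (x₀ : X) : Prop where
  E : ContDiffAt ℝ k (fun x => (P x).E) x₀
  A : ContDiffAt ℝ k (fun x => (P x).A) x₀
  B : ContDiffAt ℝ k (fun x => (P x).B) x₀
  C : ContDiffAt ℝ k (fun x => (P x).C) x₀

variable {P : X → Descriptor r m p} {v : X → ℝ}

theorem ContDiffFamilyAt.reduce {P : X → Descriptor n m p} (hP : ContDiffFamilyAt k P x₀)
    {V W : X → Matrix (Fin n) (Fin r) ℂ} (hV : ContDiffAt ℝ k V x₀) (hW : ContDiffAt ℝ k W x₀) :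
    ContDiffFamilyAt k (fun x => (P x).reduce (V x) (W x)) x₀ where
  E := contDiffAt_matrix_mul (contDiffAt_matrix_mul (contDiffAt_matrix_conjTranspose hW) hP.E) hV
  A := contDiffAt_matrix_mul (contDiffAt_matrix_mul (contDiffAt_matrix_conjTranspose hW) hP.A) hV
  B := contDiffAt_matrix_mul (contDiffAt_matrix_conjTranspose hW) hP.B
  C := contDiffAt_matrix_mul hP.C hV

theorem ContDiffFamilyAt.contDiffAt_D (hP : ContDiffFamilyAt k P x₀) (hv : ContDiffAt ℝ k v x₀) :
    ContDiffAt ℝ k (fun x => (P x).D (Complex.I * v x)) x₀ :=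
  ((contDiffAt_const.mul (Complex.ofRealCLM.contDiff.contDiffAt.comp x₀ hv)).smul hP.E).sub hP.A

theorem ContDiffFamilyAt.eventually_det_ne_zero (hP : ContDiffFamilyAt k P x₀)
    (hv : ContDiffAt ℝ k v x₀) (hdet : ((P x₀).D (Complex.I * v x₀)).det ≠ 0) :
    ∀ᶠ x in 𝓝 x₀, ((P x).D (Complex.I * v x)).det ≠ 0 :=
  (contDiffAt_matrix_det (hP.contDiffAt_D hv)).continuousAt.eventually_ne hdet

theorem ContDiffFamilyAt.contDiffAt_H (hP : ContDiffFamilyAt k P x₀) (hv : ContDiffAt ℝ k v x₀)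
    (hdet : ((P x₀).D (Complex.I * v x₀)).det ≠ 0) :
    ContDiffAt ℝ k (fun x => (P x).H (Complex.I * v x)) x₀ := by
  refine (contDiffAt_matrix_mul (contDiffAt_matrix_mul hP.C
    (contDiffAt_matrix_inv (hP.contDiffAt_D hv) hdet)) hP.B).congr_of_eventuallyEq ?_
  filter_upwards [hP.eventually_det_ne_zero hv hdet] with x hx
  exact (P x).H_eq_of_det_ne_zero hx

theorem ContDiffFamilyAt.contDiffAt_sigma (hP : ContDiffFamilyAt k P x₀) (hv : ContDiffAt ℝ k v x₀)
    (hdet : ((P x₀).D (Complex.I * v x₀)).det ≠ 0)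
    (hn : ContDiffAt ℝ k (‖·‖) ((P x₀).H (Complex.I * v x₀))) :
    ContDiffAt ℝ k (fun x => (P x).sigma (v x)) x₀ := by
  simp only [sigma_eq_norm]
  exact hn.comp x₀ (hP.contDiffAt_H hv hdet)

end Smooth

section Interpolation

variable {V W : Matrix (Fin n) (Fin r) ℂ} {ω : ℝ}

theorem InterpolatedBy.le_colSpace_or {P : Descriptor n m p} (h : P.InterpolatedBy V W ω) :
    (colSpace ((P.D (Complex.I * ω))⁻¹ * P.B) ≤ colSpace V ∧
      colSpace (((P.D (Complex.I * ω))⁻¹)ᴴ * P.Cᴴ * P.H (Complex.I * ω)) ≤ colSpace W) ∨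
    (colSpace ((P.D (Complex.I * ω))⁻¹ * P.B * (P.H (Complex.I * ω))ᴴ) ≤ colSpace V ∧
      colSpace (((P.D (Complex.I * ω))⁻¹)ᴴ * P.Cᴴ) ≤ colSpace W) := by
  obtain ⟨hV, hW⟩ := h
  rcases le_or_gt m p with hmp | hmp
  · rw [expandV, if_pos hmp] at hV
    refine .inl ⟨hV, ?_⟩
    rw [expandW] at hW
    split_ifs at hW
    · refine le_trans ?_ hW
      rw [colSpace, Matrix.mulVecLin_mul]
      exact LinearMap.range_comp_le_range _ _
    · exact hW
  · rw [expandV, if_neg hmp.not_ge] at hV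
    rw [expandW, if_pos hmp.le] at hW
    exact .inr ⟨hV, hW⟩

theorem InterpolatedBy.H_reduce {P : Descriptor n m p} (h : P.InterpolatedBy V W ω)
    (hdet : (P.D (Complex.I * ω)).det ≠ 0)
    (hred : ((P.reduce V W).D (Complex.I * ω)).det ≠ 0) :
    (P.reduce V W).H (Complex.I * ω) = P.H (Complex.I * ω) := by
  have hsub := H_sub_H_reduce hdet hred
  rw [reduce_D] at hred
  suffices P.C * invError (P.D (Complex.I * ω)) V W * P.B = 0 from
    (sub_eq_zero.1 (hsub.trans this)).symm
  rcases h.le_colSpace_or with ⟨hV, -⟩ | ⟨-, hW⟩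
  · obtain ⟨Y, hY⟩ := exists_eq_mul_mul_of_colSpace_le hdet hV
    rw [hY, Matrix.mul_assoc, ← Matrix.mul_assoc (invError _ _ _), invError_mul_mul hdet hred,
      Matrix.zero_mul, Matrix.mul_zero]
  · obtain ⟨Z, hZ⟩ := exists_eq_mul_conjTranspose_mul_of_colSpace_le hdet hW
    rw [hZ, Matrix.mul_assoc Z, mul_mul_invError hdet hred, Matrix.mul_zero, Matrix.zero_mul]

variable {X : Type*} [NormedAddCommGroup X] [NormedSpace ℝ X] {x₀ : X}

theorem InterpolatedBy.fderiv_sigma_reduce {P : X → Descriptor n m p} {v : X → ℝ}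
    (h : (P x₀).InterpolatedBy V W (v x₀)) (hP : ContDiffFamilyAt 1 P x₀) (hv : ContDiffAt ℝ 1 v x₀)
    (hdet : ((P x₀).D (Complex.I * v x₀)).det ≠ 0)
    (hred : (((P x₀).reduce V W).D (Complex.I * v x₀)).det ≠ 0)
    (hpos : (P x₀).H (Complex.I * v x₀) ≠ 0)
    (hn : DifferentiableAt ℝ (‖·‖) ((P x₀).H (Complex.I * v x₀))) :
    fderiv ℝ (fun x => ((P x).reduce V W).sigma (v x)) x₀ =
      fderiv ℝ (fun x => (P x).sigma (v x)) x₀ := by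
  have hP' : ContDiffFamilyAt 1 (fun x => (P x).reduce V W) x₀ :=
    hP.reduce contDiffAt_const contDiffAt_const
  have hH := (hP.contDiffAt_H hv hdet).differentiableAt one_ne_zero
  have hH' := (hP'.contDiffAt_H hv hred).differentiableAt one_ne_zero
  have hval := h.H_reduce hdet hred
  have hsub : ∀ᶠ x in 𝓝 x₀, (P x).H (Complex.I * v x) - ((P x).reduce V W).H (Complex.I * v x) =
      (P x).C * invError ((P x).D (Complex.I * v x)) V W * (P x).B := by
    filter_upwards [hP.eventually_det_ne_zero hv hdet, hP'.eventually_det_ne_zero hv hred] with x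
    exact H_sub_H_reduce
  rw [reduce_D] at hred
  simp only [sigma_eq_norm]
  set M₀ := (P x₀).H (Complex.I * v x₀) with hM₀
  rcases h.le_colSpace_or with ⟨hV, hW⟩ | ⟨hV, hW⟩
  · refine fderiv_norm_comp_eq_of_conjTranspose_mul hH hH' hval hn hpos ?_
    refine (hasFDerivAt_zero_mul_invError_mul (K := fun x => M₀ᴴ * (P x).C) (hP.contDiffAt_D hv)
      (contDiffAt_matrix_mul contDiffAt_const hP.C) hP.B hdet hred hV ?_).congr_of_eventuallyEq ?_
    · rwa [Matrix.conjTranspose_mul, Matrix.conjTranspose_conjTranspose, ← Matrix.mul_assoc]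
    · filter_upwards [hsub] with x hx
      simp only [hx, hM₀, Matrix.mul_assoc]
  · refine fderiv_norm_comp_eq_of_mul_conjTranspose hH hH' hval hn hpos ?_
    refine (hasFDerivAt_zero_mul_invError_mul (L := fun x => (P x).B * M₀ᴴ) (hP.contDiffAt_D hv)
      hP.C (contDiffAt_matrix_mul hP.B contDiffAt_const) hdet hred ?_ hW).congr_of_eventuallyEq ?_
    · rwa [← Matrix.mul_assoc]
    · filter_upwards [hsub] with x hx
      simp only [hx, hM₀, Matrix.mul_assoc]

end Interpolation

end Descriptor

theorem eventually_forall_notMem_lt {X Y : Type*} [TopologicalSpace X] [TopologicalSpace Y]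
    [CompactSpace Y] {f : X × Y → ℝ} {x₀ : X} {y₀ : Y} (hcont : ∀ y, ContinuousAt f (x₀, y))
    (hmax : ∀ y ≠ y₀, f (x₀, y) < f (x₀, y₀)) {U : Set Y} (hU : U ∈ 𝓝 y₀) :
    ∀ᶠ x in 𝓝 x₀, ∀ y ∉ U, f (x, y) < f (x, y₀) := by
  have hK : IsCompact (interior U)ᶜ := isOpen_interior.isClosed_compl.isCompact
  have hout : ∀ᶠ x in 𝓝 x₀, ∀ y ∈ (interior U)ᶜ, f (x, y) < f (x, y₀) := by
    refine hK.eventually_forall_of_forall_eventually fun y hy => ?_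
    have hne : y ≠ y₀ := by
      rintro rfl
      exact hy (mem_interior_iff_mem_nhds.2 hU)
    have hconst : ContinuousAt (fun z : X × Y => f (z.1, y₀)) (x₀, y) :=
      ContinuousAt.comp (g := f) (f := fun z : X × Y => (z.1, y₀)) (hcont y₀) (by fun_prop)
    exact (hcont y).eventually_lt hconst (hmax y hne)
  filter_upwards [hout] with x hx y hy using hx y fun hy' => hy (interior_subset hy')

namespace Descriptor

variable {r m p : ℕ}

theorem exists_isPeak_of_forall_lt {P : Descriptor r m p} {ω₀ η : ℝ} (hη : 0 ≤ η)
    (hc : ContinuousOn P.sigma (Metric.closedBall ω₀ η))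
    (hout : ∀ ω ∉ ((↑) : ℝ → OnePoint ℝ) '' Metric.closedBall ω₀ η,
      P.sigmaExt ω < P.sigma ω₀) :
    ∃ ω, P.IsPeak ω := by
  obtain ⟨ω₁, -, hω₁⟩ := (isCompact_closedBall ω₀ η).exists_isMaxOn
    ⟨ω₀, Metric.mem_closedBall_self hη⟩ hc
  refine ⟨ω₁, fun ω => ?_⟩
  by_cases hω : ω ∈ ((↑) : ℝ → OnePoint ℝ) '' Metric.closedBall ω₀ η
  · obtain ⟨ω', hω', rfl⟩ := hω
    exact hω₁ hω'
  · exact (hout ω hω).le.trans (hω₁ (Metric.mem_closedBall_self hη))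

theorem IsPeak.mem_of_forall_lt {P : Descriptor r m p} {ω ω₀ : ℝ} (h : P.IsPeak ω) {U : Set ℝ}
    (hout : ∀ ω ∉ ((↑) : ℝ → OnePoint ℝ) '' U, P.sigmaExt ω < P.sigma ω₀) : ω ∈ U := by
  by_contra hω
  refine (h (ω₀ : OnePoint ℝ)).not_gt (hout ω ?_)
  rintro ⟨ω', hω', he⟩
  exact hω (OnePoint.coe_injective he ▸ hω')

theorem IsPeak.sigma_le {P : Descriptor r m p} {ω₀ : ℝ} (h : P.IsPeak ω₀) (ω : ℝ) :
    P.sigma ω ≤ P.sigma ω₀ :=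
  h (ω : OnePoint ℝ)

theorem IsPeak.hasDerivAt {P : Descriptor r m p} {ω : ℝ} (h : P.IsPeak ω)
    (hd : DifferentiableAt ℝ P.sigma ω) : HasDerivAt P.sigma 0 ω := by
  have hmax : IsLocalMax P.sigma ω := Eventually.of_forall h.sigma_le
  simpa only [hmax.deriv_eq_zero] using hd.hasDerivAt

theorem IsHinf.hinfNorm_eq_of_isPeak {P : Descriptor r m p} (hP : P.IsHinf) {ω : ℝ}
    (h : P.IsPeak ω) : P.hinfNorm = P.sigma ω :=
  hP.hinfNorm_eq h.sigma_le

section PeakBranch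

variable {X : Type*} [NormedAddCommGroup X] [NormedSpace ℝ X] {k : WithTop ℕ∞}
  {P : X → Descriptor r m p} {x₀ : X} {ω₀ : ℝ}

theorem ContDiffFamilyAt.comp {Y : Type*} [NormedAddCommGroup Y] [NormedSpace ℝ Y] {u : Y → X}
    {y₀ : Y} (hP : ContDiffFamilyAt k P (u y₀)) (hu : ContDiffAt ℝ k u y₀) :
    ContDiffFamilyAt k (fun y => P (u y)) y₀ where
  E := hP.E.comp (f := u) y₀ hu
  A := hP.A.comp (f := u) y₀ hu
  B := hP.B.comp (f := u) y₀ hu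
  C := hP.C.comp (f := u) y₀ hu

theorem ContDiffFamilyAt.contDiffAt_sigma_uncurry (hP : ContDiffFamilyAt k P x₀)
    (hdet : ((P x₀).D (Complex.I * ω₀)).det ≠ 0)
    (hn : ContDiffAt ℝ k (‖·‖) ((P x₀).H (Complex.I * ω₀))) :
    ContDiffAt ℝ k (fun z : X × ℝ => (P z.1).sigma z.2) (x₀, ω₀) :=
  (hP.comp (u := Prod.fst) (y₀ := (x₀, ω₀)) contDiffAt_fst).contDiffAt_sigma contDiffAt_snd hdet hn

theorem exists_peak_branch [CompleteSpace X] (hk : 1 ≤ k) (hP : ContDiffFamilyAt (k + 1) P x₀)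
    (hdet : ((P x₀).D (Complex.I * ω₀)).det ≠ 0)
    (hn : ContDiffAt ℝ (k + 1) (‖·‖) ((P x₀).H (Complex.I * ω₀)))
    (hcont : ∀ ω : OnePoint ℝ,
      ContinuousAt (fun z : X × OnePoint ℝ => (P z.1).sigmaExt z.2) (x₀, ω))
    (hmax : ∀ ω : OnePoint ℝ, ω ≠ ω₀ → (P x₀).sigmaExt ω < (P x₀).sigma ω₀)
    (hωω : iteratedDeriv 2 (P x₀).sigma ω₀ ≠ 0) :
    ∃ G : X → ℝ, ContDiffAt ℝ k G x₀ ∧ G x₀ = ω₀ ∧ ∀ᶠ x in 𝓝 x₀, ∀ ω, (P x).IsPeak ω ↔ ω = G x := by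
  have hσ := hP.contDiffAt_sigma_uncurry hdet hn
  have hpeak : (P x₀).IsPeak ω₀ := fun ω =>
    (eq_or_ne ω ω₀).elim (fun h => h ▸ le_rfl) fun h => (hmax ω h).le
  have hdiff : ∀ᶠ z : X × ℝ in 𝓝 (x₀, ω₀), DifferentiableAt ℝ (P z.1).sigma z.2 :=
    ((hσ.of_le le_add_self).eventually (by simp)).mono fun z hz =>
      (hasDerivAt_derivSnd (hz.differentiableAt one_ne_zero)).differentiableAt
  obtain ⟨G, hG, hG₀, hiff⟩ := exists_stationary_branch hk hσ
    ((hasDerivAt_zero_iff_derivSnd_eq_zero (hσ.differentiableAt (by simp))).1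
      (hpeak.hasDerivAt hdiff.self_of_nhds))
    (iteratedDeriv_two_eq_derivSnd (hσ.of_le
      (one_add_one_eq_two.symm.le.trans (add_le_add hk le_rfl))) ▸ hωω)
  refine ⟨G, hG, hG₀, ?_⟩
  have hlim : Tendsto (Prod.fst : ℝ × X → ℝ) (𝓝[>] 0 ×ˢ 𝓝 x₀) (𝓝 0) :=
    tendsto_nhds_of_tendsto_nhdsWithin tendsto_fst
  obtain ⟨η, hball, hη⟩ := ((eventually_forall_mem_closedBall tendsto_snd hlim
    (hdiff.and hiff)).curry.and self_mem_nhdsWithin).exists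
  have hU : ((↑) : ℝ → OnePoint ℝ) '' Metric.closedBall ω₀ η ∈ 𝓝 (ω₀ : OnePoint ℝ) :=
    OnePoint.isOpenEmbedding_coe.image_mem_nhds.2 (Metric.closedBall_mem_nhds _ hη)
  filter_upwards [hball, eventually_forall_notMem_lt hcont hmax hU] with x hx hout
  have hunique : ∀ ω, (P x).IsPeak ω → ω = G x := fun ω hω =>
    have hmem := hω.mem_of_forall_lt hout
    ((hx ω hmem).2.1 (hω.hasDerivAt (hx ω hmem).1)).symm
  obtain ⟨ω₁, hω₁⟩ := exists_isPeak_of_forall_lt (le_of_lt hη)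
    (fun ω hω => (hx ω hω).1.continuousAt.continuousWithinAt) hout
  refine fun ω => ⟨hunique ω, ?_⟩
  rintro rfl
  exact hunique ω₁ hω₁ ▸ hω₁

end PeakBranch

end Descriptor

variable {d n m p r : ℕ}

theorem AgreesToFirstOrderAt.of_eventuallyEq {φ : Param d × ℝ → ℝ} {F G : Param d → ℝ} {μ : Param d}
    (hφ : DifferentiableAt ℝ φ (μ, G μ)) (hG : DifferentiableAt ℝ G μ)
    (h₀ : HasDerivAt (fun ω => φ (μ, ω)) 0 (G μ)) (hF : F =ᶠ[𝓝 μ] fun ν => φ (ν, G ν)) :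
    AgreesToFirstOrderAt φ F (μ, G μ) := by
  refine ⟨hF.self_of_nhds.symm, ?_⟩
  have hω : fderiv ℝ φ (μ, G μ) (0, 1) = 0 := (hasDerivAt_derivSnd hφ).unique h₀
  have hchain : fderiv ℝ F μ = fderiv ℝ φ (μ, G μ) ∘L (.prod (.id ℝ _) (fderiv ℝ G μ)) :=
    ((hφ.hasFDerivAt.comp (f := fun ν => (ν, G ν)) μ
      ((hasFDerivAt_id μ).prodMk hG.hasFDerivAt)).congr_of_eventuallyEq hF).fderiv
  convert hφ.hasFDerivAt using 1
  refine ContinuousLinearMap.ext fun ⟨v, s⟩ => ?_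
  have hsplit (v : Param d) (s : ℝ) :
      fderiv ℝ φ (μ, G μ) (v, s) = fderiv ℝ φ (μ, G μ) (v, 0) := by
    rw [show ((v, s) : Param d × ℝ) = (v, 0) + s • (0, 1) by simp, map_add, map_smul, hω,
      smul_zero, add_zero]
  simp [hchain, hsplit v s, hsplit v (fderiv ℝ G μ v)]

/-- Two matrices of the same size, as they span the two subspaces of a Petrov-Galerkin reduction. -/
abbrev BasisPair (n r : ℕ) : Type := Matrix (Fin n) (Fin r) ℂ × Matrix (Fin n) (Fin r) ℂ

namespace Descriptor

variable {P : Param d → Descriptor n m p} {F G : Param d → ℝ} {μs : Param d}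

theorem InterpolatedBy.agreesToFirstOrderAt {V W : Matrix (Fin n) (Fin r) ℂ} {ωs : ℝ}
    (h : (P μs).InterpolatedBy V W ωs) (hP : ContDiffFamilyAt 1 P μs)
    (hdet : ((P μs).D (Complex.I * ωs)).det ≠ 0)
    (hred : (((P μs).reduce V W).D (Complex.I * ωs)).det ≠ 0)
    (hpos : (P μs).H (Complex.I * ωs) ≠ 0)
    (hn : ContDiffAt ℝ 1 (‖·‖) ((P μs).H (Complex.I * ωs)))
    (hF : AgreesToFirstOrderAt (fun z => (P z.1).sigma z.2) F (μs, ωs)) :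
    AgreesToFirstOrderAt (fun z => ((P z.1).reduce V W).sigma z.2) F (μs, ωs) := by
  have hH : ((P μs).reduce V W).H (Complex.I * ωs) = (P μs).H (Complex.I * ωs) :=
    h.H_reduce hdet hred
  have hn' : ContDiffAt ℝ 1 (‖·‖) (((P μs).reduce V W).H (Complex.I * ωs)) := by rwa [hH]
  have hP' : ContDiffFamilyAt 1 (fun z : Param d × ℝ => P z.1) (μs, ωs) :=
    hP.comp (u := Prod.fst) contDiffAt_fst
  have hdiff :
      DifferentiableAt ℝ (fun z : Param d × ℝ => ((P z.1).reduce V W).sigma z.2) (μs, ωs) :=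
    (ContDiffFamilyAt.contDiffAt_sigma_uncurry (P := fun μ => (P μ).reduce V W)
      (hP.reduce contDiffAt_const contDiffAt_const) hred hn').differentiableAt one_ne_zero
  refine ⟨?_, ?_⟩
  · simpa only [sigma_eq_norm, hH] using hF.1
  · have hfderiv := InterpolatedBy.fderiv_sigma_reduce (P := fun z : Param d × ℝ => P z.1)
      (v := Prod.snd) (x₀ := (μs, ωs)) h hP' contDiffAt_snd hdet hred hpos
      (hn.differentiableAt one_ne_zero)
    rw [← hF.2.fderiv, ← hfderiv]
    exact hdiff.hasFDerivAt

theorem ContDiffFamilyAt.eventually {k : WithTop ℕ∞} (hP : ContDiffFamilyAt k P μs)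
    (hk : k ≠ (⊤ : ℕ∞)) : ∀ᶠ μ in 𝓝 μs, ContDiffFamilyAt k P μ := by
  filter_upwards [hP.E.eventually hk, hP.A.eventually hk, hP.B.eventually hk, hP.C.eventually hk]
    with μ hE hA hB hC using ⟨hE, hA, hB, hC⟩

theorem ContDiffFamilyAt.of_le {k l : WithTop ℕ∞} (hP : ContDiffFamilyAt k P μs) (h : l ≤ k) :
    ContDiffFamilyAt l P μs :=
  ⟨hP.E.of_le h, hP.A.of_le h, hP.B.of_le h, hP.C.of_le h⟩

theorem eventually_agreesToFirstOrderAt_hinfNorm (hP : ContDiffFamilyAt 1 P μs)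
    (hG : ContDiffAt ℝ 1 G μs) (hdet : ((P μs).D (Complex.I * G μs)).det ≠ 0)
    (hn : ContDiffAt ℝ 1 (‖·‖) ((P μs).H (Complex.I * G μs)))
    (hinf : ∀ᶠ μ in 𝓝 μs, (P μ).IsHinf) (hpeak : ∀ᶠ μ in 𝓝 μs, (P μ).IsPeak (G μ)) :
    ∀ᶠ μ in 𝓝 μs, AgreesToFirstOrderAt (fun z => (P z.1).sigma z.2) (fun ν => (P ν).hinfNorm)
      (μ, G μ) := by
  have hlift : Tendsto (fun μ => (μ, G μ)) (𝓝 μs) (𝓝 (μs, G μs)) :=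
    continuousAt_id.prodMk hG.continuousAt
  filter_upwards [hlift.eventually ((hP.contDiffAt_sigma_uncurry hdet hn).eventually (by simp)),
    hG.eventually (by simp), (hinf.and hpeak).eventually_nhds] with μ hσ hGμ hμ
  have hσ' := hσ.differentiableAt one_ne_zero
  exact .of_eventuallyEq hσ' (hGμ.differentiableAt one_ne_zero)
    (hμ.self_of_nhds.2.hasDerivAt (hasDerivAt_derivSnd hσ').differentiableAt)
    (hμ.mono fun ν hν => hν.1.hinfNorm_eq_of_isPeak hν.2)

theorem contDiffAt_hinfNorm {k : WithTop ℕ∞} (hP : ContDiffFamilyAt k P μs)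
    (hG : ContDiffAt ℝ k G μs) (hdet : ((P μs).D (Complex.I * G μs)).det ≠ 0)
    (hn : ContDiffAt ℝ k (‖·‖) ((P μs).H (Complex.I * G μs)))
    (hinf : ∀ᶠ μ in 𝓝 μs, (P μ).IsHinf) (hpeak : ∀ᶠ μ in 𝓝 μs, (P μ).IsPeak (G μ)) :
    ContDiffAt ℝ k (fun μ => (P μ).hinfNorm) μs :=
  (hP.contDiffAt_sigma hG hdet hn).congr_of_eventuallyEq <|
    (hinf.and hpeak).mono fun _ hμ => hμ.1.hinfNorm_eq_of_isPeak hμ.2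

section ReducedFamily

variable {θ₀ : BasisPair n r}

theorem ContDiffFamilyAt.reduce_uncurry {k : WithTop ℕ∞} (hP : ContDiffFamilyAt k P μs) :
    ContDiffFamilyAt k (fun y : BasisPair n r × Param d => (P y.2).reduce y.1.1 y.1.2) (θ₀, μs) :=
  (hP.comp (u := Prod.snd) (y₀ := (θ₀, μs)) contDiffAt_snd).reduce
    (contDiffAt_fst.comp _ contDiffAt_fst) (contDiffAt_snd.comp _ contDiffAt_fst)

theorem eventually_agreesToFirstOrderAt_reduce (hP : ContDiffFamilyAt 1 P μs)
    (hG : ContDiffAt ℝ 1 G μs) (hdet : ((P μs).D (Complex.I * G μs)).det ≠ 0)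
    (hred : (((P μs).reduce θ₀.1 θ₀.2).D (Complex.I * G μs)).det ≠ 0)
    (hpos : (P μs).H (Complex.I * G μs) ≠ 0)
    (hn : ContDiffAt ℝ 1 (‖·‖) ((P μs).H (Complex.I * G μs)))
    (hF : ∀ᶠ μ in 𝓝 μs, AgreesToFirstOrderAt (fun z => (P z.1).sigma z.2) F (μ, G μ)) :
    ∀ᶠ y in 𝓝 (θ₀, μs), (P y.2).InterpolatedBy y.1.1 y.1.2 (G y.2) →
      AgreesToFirstOrderAt (fun z => ((P z.1).reduce y.1.1 y.1.2).sigma z.2) F (y.2, G y.2) := by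
  have hH := (hP.contDiffAt_H hG hdet).continuousAt
  have hfull : ∀ᶠ μ in 𝓝 μs, ContDiffFamilyAt 1 P μ ∧ ((P μ).D (Complex.I * G μ)).det ≠ 0 ∧
      (P μ).H (Complex.I * G μ) ≠ 0 ∧ ContDiffAt ℝ 1 (‖·‖) ((P μ).H (Complex.I * G μ)) ∧
      AgreesToFirstOrderAt (fun z => (P z.1).sigma z.2) F (μ, G μ) :=
    (hP.eventually (by simp)).and <| (hP.eventually_det_ne_zero hG hdet).and <|
      (hH.eventually_ne hpos).and <| (hH.eventually (hn.eventually (by simp))).and hF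
  filter_upwards [continuousAt_snd.eventually hfull, hP.reduce_uncurry.eventually_det_ne_zero
    (hG.comp (f := Prod.snd) (θ₀, μs) contDiffAt_snd) hred]
  rintro ⟨θ, μ⟩ ⟨hPμ, hdetμ, hposμ, hnμ, hFμ⟩ hredμ h
  exact h.agreesToFirstOrderAt hPμ hdetμ hredμ hposμ hnμ hFμ

theorem eventually_not_interpolatedBy (hP : ContDiffFamilyAt 1 P μs)
    (hG : ContDiffAt ℝ 1 G μs) (hdet : ((P μs).D (Complex.I * G μs)).det ≠ 0)
    (hred : (((P μs).reduce θ₀.1 θ₀.2).D (Complex.I * G μs)).det ≠ 0)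
    (hne : ((P μs).reduce θ₀.1 θ₀.2).H (Complex.I * G μs) ≠ (P μs).H (Complex.I * G μs)) :
    ∀ᶠ y in 𝓝 (θ₀, μs), ¬(P y.2).InterpolatedBy y.1.1 y.1.2 (G y.2) := by
  have hG' : ContDiffAt ℝ 1 (fun y : BasisPair n r × Param d => G y.2) (θ₀, μs) :=
    hG.comp (f := Prod.snd) (θ₀, μs) contDiffAt_snd
  have hP' : ContDiffFamilyAt 1 (fun y : BasisPair n r × Param d => P y.2) (θ₀, μs) :=
    hP.comp (u := Prod.snd) (y₀ := (θ₀, μs)) contDiffAt_snd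
  filter_upwards [hP'.eventually_det_ne_zero hG' hdet,
    hP.reduce_uncurry.eventually_det_ne_zero hG' hred,
    (hP.reduce_uncurry.contDiffAt_H hG' hred).continuousAt.ne_iff_eventually_ne
      (hP'.contDiffAt_H hG' hdet).continuousAt |>.1 hne] with y hdety hredy hney h
  exact hney (h.H_reduce hdety hredy)

theorem eventually_hasHessianBound_reduce {δ : ℝ} (hδ : δ < 0) (hP : ContDiffFamilyAt 4 P μs)
    (hF : ContDiffAt ℝ 3 F μs) (hG : ContDiffAt ℝ 1 G μs)
    (hdet : ((P μs).D (Complex.I * G μs)).det ≠ 0)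
    (hred : (((P μs).reduce θ₀.1 θ₀.2).D (Complex.I * G μs)).det ≠ 0)
    (hpos : (P μs).H (Complex.I * G μs) ≠ 0)
    (hn : ContDiffAt ℝ 4 (‖·‖) ((P μs).H (Complex.I * G μs)))
    (hagree : ∀ᶠ μ in 𝓝 μs, AgreesToFirstOrderAt (fun z => (P z.1).sigma z.2) F (μ, G μ)) :
    ∀ᶠ x : ℝ × BasisPair n r in 𝓝[>] 0 ×ˢ 𝓝 θ₀,
      iteratedDeriv 2 ((P μs).reduce x.2.1 x.2.2).sigma (G μs) ≤ δ →
      HasHessianBound (fun ν => ((P ν).reduce x.2.1 x.2.2).sigma) F G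
        {μ | (P μ).InterpolatedBy x.2.1 x.2.2 (G μ)} μs x.1 := by
  have hP₁ : ContDiffFamilyAt 1 P μs := hP.of_le (by norm_num)
  by_cases hH : ((P μs).reduce θ₀.1 θ₀.2).H (Complex.I * G μs) = (P μs).H (Complex.I * G μs)
  · have hI := eventually_agreesToFirstOrderAt_reduce hP₁ hG hdet hred hpos
      (hn.of_le (by norm_num)) hagree
    rw [← hH] at hn
    have : CompleteSpace (BasisPair n r) := FiniteDimensional.complete ℂ _
    exact eventually_hasHessianBound
      (Φ := fun z : (BasisPair n r × Param d) × ℝ => ((P z.1.2).reduce z.1.1.1 z.1.1.2).sigma z.2)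
      (I := fun θ => {μ | (P μ).InterpolatedBy θ.1 θ.2 (G μ)}) hδ
      (hP.reduce_uncurry.contDiffAt_sigma_uncurry hred hn) hF hG hI
  · filter_upwards [eventually_forall_mem_closedBall tendsto_snd
      (tendsto_fst_pow θ₀ three_ne_zero) (eventually_not_interpolatedBy hP₁ hG hdet hred hH)]
    rintro ⟨t, θ⟩ hx - μ hμ h - s - hμI -
    exact absurd hμI (hx μ (Metric.ball_subset_closedBall hμ))

end ReducedFamily

end Descriptor

section Compactness

theorem eventually_forall_mem_of_isCompact {ι X : Type*} [TopologicalSpace X] {K : Set X}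
    (hK : IsCompact K) {l : Filter ι} {Q : ι × X → Prop}
    (h : ∀ x ∈ K, ∀ᶠ z in l ×ˢ 𝓝 x, Q z) : ∀ᶠ i in l, ∀ x ∈ K, Q (i, x) :=
  eventually_prod_principal_iff.1 <|
    (show ∀ᶠ z in l ×ˢ 𝓝ˢ K, Q z from hK.mem_prod_nhdsSet_of_forall h).filter_mono
      (prod_mono_right _ principal_le_nhdsSet)

variable {n r : ℕ} {V : Matrix (Fin n) (Fin r) ℂ}

theorem norm_le_one_of_conjTranspose_mul_self_eq_one (hV : Vᴴ * V = 1) : ‖V‖ ≤ 1 := by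
  have hsq : ‖V‖ * ‖V‖ ≤ 1 := by
    rw [← Matrix.l2_opNorm_conjTranspose_mul_self, hV, Matrix.l2_opNorm_def]
    refine ContinuousLinearMap.opNorm_le_bound _ zero_le_one fun x => ?_
    simp
  nlinarith [norm_nonneg V]

theorem card_le_of_conjTranspose_mul_self_eq_one (hV : Vᴴ * V = 1) : r ≤ n := by
  have hinj : Function.Injective V.mulVecLin := fun x y hxy => by
    simpa [Matrix.mulVec_mulVec, hV] using congrArg (Vᴴ *ᵥ ·) hxy
  simpa using LinearMap.finrank_le_finrank_of_injective hinj

/-- The pairs of orthonormal bases `V`, `W` with `σ_min(W^* M V) ≥ β`, the last condition being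
written as a bound from below for the image of every vector. -/
def admissibleBases (M : Matrix (Fin n) (Fin n) ℂ) (r : ℕ) (β : ℝ) : Set (BasisPair n r) :=
  {θ | θ.1ᴴ * θ.1 = 1 ∧ θ.2ᴴ * θ.2 = 1 ∧
    ∀ x, β * ‖x‖ ≤ ‖Matrix.toEuclideanLin (θ.2ᴴ * M * θ.1) x‖}

theorem isCompact_admissibleBases (M : Matrix (Fin n) (Fin n) ℂ) (r : ℕ) (β : ℝ) :
    IsCompact (admissibleBases M r β) := by
  have : ProperSpace (BasisPair n r) := FiniteDimensional.proper ℂ _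
  refine Metric.isCompact_of_isClosed_isBounded ?_ ?_
  · have hconj : Continuous fun V : Matrix (Fin n) (Fin r) ℂ => Vᴴ :=
      continuous_id.matrix_conjTranspose
    have hclosed : IsClosed {V : Matrix (Fin n) (Fin r) ℂ | Vᴴ * V = 1} :=
      isClosed_eq (hconj.matrix_mul continuous_id) continuous_const
    have hlin (x : EuclideanSpace ℂ (Fin r)) :
        Continuous fun N : Matrix (Fin r) (Fin r) ℂ => Matrix.toEuclideanLin N x := by
      let L : Matrix (Fin r) (Fin r) ℂ →ₗ[ℂ] EuclideanSpace ℂ (Fin r) :=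
        LinearMap.applyₗ x ∘ₗ Matrix.toEuclideanLin.toLinearMap
      exact (LinearMap.continuous_of_finiteDimensional L :)
    have hbelow : IsClosed {θ : BasisPair n r |
        ∀ x, β * ‖x‖ ≤ ‖Matrix.toEuclideanLin (θ.2ᴴ * M * θ.1) x‖} := by
      simp only [ofPred_forall]
      exact isClosed_iInter fun x => isClosed_le continuous_const
        ((hlin x).comp (((hconj.comp continuous_snd).matrix_mul continuous_const).matrix_mul
          continuous_fst)).norm
    exact (hclosed.preimage continuous_fst).inter ((hclosed.preimage continuous_snd).inter hbelow)
  · refine isBounded_iff_forall_norm_le.2 ⟨1, fun θ hθ => ?_⟩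
    exact norm_prod_le_iff.2 ⟨norm_le_one_of_conjTranspose_mul_self_eq_one hθ.1,
      norm_le_one_of_conjTranspose_mul_self_eq_one hθ.2.1⟩

end Compactness

namespace ParamSystem

variable {d n m p : ℕ} (S : ParamSystem d n m p)

theorem reduced_eq {r : ℕ} (V W : Matrix (Fin n) (Fin r) ℂ) (μ : Param d) :
    S.reduced V W μ = (S.full μ).reduce V W := by
  simp only [reduced, full, Descriptor.reduce, Matrix.mul_sum, Matrix.sum_mul, Matrix.mul_smul,
    Matrix.smul_mul]

variable {S}

theorem contDiffAt_sum_smul {ι : Type*} [Fintype ι] {a b : ℕ} {f : ι → Param d → ℝ} {k : WithTop ℕ∞}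
    {M : ι → Matrix (Fin a) (Fin b) ℂ} {μ : Param d} (hf : ∀ j, ContDiffAt ℝ k (f j) μ) :
    ContDiffAt ℝ k (fun ν => ∑ j, (f j ν : ℂ) • M j) μ :=
  ContDiffAt.sum fun j _ =>
    (Complex.ofRealCLM.contDiff.contDiffAt.comp μ (hf j)).smul contDiffAt_const

theorem IsAnalytic.contDiffFamilyAt {Ω : Set (Param d)} (hS : S.IsAnalytic Ω) {μ : Param d}
    (hμ : μ ∈ Ω) (k : WithTop ℕ∞) : Descriptor.ContDiffFamilyAt k S.full μ where
  E := contDiffAt_sum_smul fun j => (hS.1 j μ hμ).contDiffAt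
  A := contDiffAt_sum_smul fun j => (hS.2.1 j μ hμ).contDiffAt
  B := contDiffAt_sum_smul fun j => (hS.2.2.1 j μ hμ).contDiffAt
  C := contDiffAt_sum_smul fun j => (hS.2.2.2 j μ hμ).contDiffAt

end ParamSystem

section Runs

variable {d n m p : ℕ} {S : ParamSystem d n m p} {Ω Ωc : Set (Param d)} {K : ℕ} {R : Run d n}
  {G : Param d → ℝ} {μs : Param d} {ρ : ℝ} {j : ℕ}

/-- Step `j + 1` produces orthonormal bases that interpolate at `μ^(j+1)` and, for all `r ≤ q`, at a
point at distance `‖μ^(j+1) - μ^(j)‖` in the direction `± e_{rq}`. All frequencies are given by `G`,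
the location of the peak as a function of the parameter. -/
structure Run.InterpolatesNear (S : ParamSystem d n m p) (G : Param d → ℝ) (R : Run d n)
    (j : ℕ) : Prop where
  orthonormal : (R.V (j + 1))ᴴ * R.V (j + 1) = 1 ∧ (R.W (j + 1))ᴴ * R.W (j + 1) = 1
  ω_eq : R.ω (j + 1) = G (R.μ (j + 1))
  interpolatedBy : (S.full (R.μ (j + 1))).InterpolatedBy (R.V (j + 1)) (R.W (j + 1))
    (G (R.μ (j + 1)))
  exists_neighbour : ∃ s : Fin d → Fin d → ℝ, (∀ r q, |s r q| = ‖R.μ (j + 1) - R.μ j‖) ∧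
    ∀ r q, r ≤ q → (S.full (R.μ (j + 1) + s r q • eDir r q)).InterpolatedBy (R.V (j + 1))
      (R.W (j + 1)) (G (R.μ (j + 1) + s r q • eDir r q))

theorem IsBasicRun.interpolatedBy (h : IsBasicRun S Ωc K R) (hj : j < K) :
    (S.full (R.μ (j + 1))).InterpolatedBy (R.V (j + 1)) (R.W (j + 1)) (R.ω (j + 1)) :=
  ⟨le_sup_right.trans_eq (h.expandV j hj).symm, le_sup_right.trans_eq (h.expandW j hj).symm⟩

theorem IsBasicRun.interpolatedBy_previous (h : IsBasicRun S Ωc K R) (hj : j + 1 < K) :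
    (S.full (R.μ (j + 1))).InterpolatedBy (R.V (j + 2)) (R.W (j + 2)) (R.ω (j + 1)) :=
  have hstep := h.interpolatedBy (j.lt_succ_self.trans hj)
  ⟨hstep.1.trans (le_sup_left.trans_eq (h.expandV _ hj).symm),
    hstep.2.trans (le_sup_left.trans_eq (h.expandW _ hj).symm)⟩

theorem add_smul_eDir_eq_of_dim_one (μ ν : Param 1) (r q : Fin 1) :
    μ + (ν 0 - μ 0) • eDir r q = ν := by
  ext i
  obtain rfl := Subsingleton.elim 0 i
  simp [eDir, Subsingleton.elim r 0, Subsingleton.elim q 0]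

theorem IsBasicRun.interpolatesNear {n m p : ℕ} {S : ParamSystem 1 n m p} {Ωc : Set (Param 1)}
    {R : Run 1 n} {G : Param 1 → ℝ} {U : Set (Param 1)} (h : IsBasicRun S Ωc K R) (hj : j + 1 < K)
    (hG : ∀ μ ∈ U, ∀ ω, (S.full μ).IsPeak ω → ω = G μ)
    (hlast : R.μ (j + 2) ∈ U) (hprev : R.μ (j + 1) ∈ U) :
    R.InterpolatesNear S G (j + 1) where
  orthonormal := h.orthonormal _ hj
  ω_eq := hG _ hlast _ (h.iterate _ hj).peak
  interpolatedBy := hG _ hlast _ (h.iterate _ hj).peak ▸ h.interpolatedBy hj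
  exists_neighbour := by
    refine ⟨fun _ _ => R.μ (j + 1) 0 - R.μ (j + 2) 0, fun _ _ => ?_, fun r q _ => ?_⟩
    · rw [EuclideanSpace.norm_eq, abs_sub_comm]
      simp [Real.sqrt_sq_eq_abs]
    · rw [add_smul_eDir_eq_of_dim_one,
        ← hG _ hprev _ (h.iterate j (j.lt_succ_self.trans hj)).peak]
      exact h.interpolatedBy_previous hj

theorem IsExtendedRun.interpolatedBy (h : IsExtendedRun S Ω Ωc K R) (hj : j < K) :
    (S.full (R.μ (j + 1))).InterpolatedBy (R.V (j + 1)) (R.W (j + 1)) (R.ω (j + 1)) :=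
  ⟨(le_sup_right.trans le_sup_left).trans_eq (h.expandV j hj).symm,
    (le_sup_right.trans le_sup_left).trans_eq (h.expandW j hj).symm⟩

theorem IsExtendedRun.interpolatedBy_adjacent (h : IsExtendedRun S Ω Ωc K R) (hj : j < K)
    (h1 : 1 ≤ j) {r q : Fin d} (hrq : r ≤ q) :
    (S.full (R.adjacent j r q)).InterpolatedBy (R.V (j + 1)) (R.W (j + 1))
      (R.ωAdj (j + 1) r q) := by
  constructor
  · rw [h.expandV j hj]
    exact le_sup_of_le_right (le_iSup_of_le h1 (le_iSup_of_le r (le_iSup_of_le q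
      (le_iSup_of_le hrq le_rfl))))
  · rw [h.expandW j hj]
    exact le_sup_of_le_right (le_iSup_of_le h1 (le_iSup_of_le r (le_iSup_of_le q
      (le_iSup_of_le hrq le_rfl))))

theorem Run.dist_adjacent_le (R : Run d n) (j : ℕ) (r q : Fin d) (μs : Param d) :
    dist (R.adjacent j r q) μs ≤ 2 * dist (R.μ (j + 1)) μs + dist (R.μ j) μs := by
  have hstep : dist (R.adjacent j r q) (R.μ (j + 1)) = dist (R.μ (j + 1)) (R.μ j) := by
    rw [adjacent, dist_eq_norm, add_sub_cancel_left, norm_smul, norm_norm, norm_eDir, mul_one,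
      dist_eq_norm]
  linarith [dist_triangle (R.adjacent j r q) (R.μ (j + 1)) μs,
    dist_triangle_right (R.μ (j + 1)) (R.μ j) μs]

theorem IsExtendedRun.interpolatesNear (h : IsExtendedRun S Ω Ωc K R) (hj : j < K) (h1 : 1 ≤ j)
    (hG : ∀ μ ∈ Metric.ball μs ρ, ∀ ω, (S.full μ).IsPeak ω → ω = G μ)
    (hlast : R.μ (j + 1) ∈ Metric.ball μs (ρ / 3)) (hprev : R.μ j ∈ Metric.ball μs (ρ / 3)) :
    R.InterpolatesNear S G j := by
  rw [Metric.mem_ball] at hlast hprev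
  have hω : R.ω (j + 1) = G (R.μ (j + 1)) :=
    hG _ (by rw [Metric.mem_ball]; linarith [dist_nonneg (x := R.μ j) (y := μs)]) _
      (h.iterate j hj).peak
  refine ⟨h.orthonormal _ hj, hω, hω ▸ h.interpolatedBy hj,
    fun _ _ => ‖R.μ (j + 1) - R.μ j‖, fun _ _ => abs_norm _, fun r q hrq => ?_⟩
  have hadj : R.adjacent j r q ∈ Metric.ball μs ρ :=
    (R.dist_adjacent_le j r q μs).trans_lt (by linarith)
  exact hG _ hadj _ (h.adjacent_peak j hj h1 r q hrq) ▸ h.interpolatedBy_adjacent hj h1 hrq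

theorem interpolatesNear_of_isBasicRun_or_isExtendedRun
    (h : (d = 1 ∧ IsBasicRun S Ωc K R) ∨ IsExtendedRun S Ω Ωc K R) (hj : j + 1 < K)
    (hG : ∀ μ ∈ Metric.ball μs ρ, ∀ ω, (S.full μ).IsPeak ω → ω = G μ)
    (hlast : R.μ (j + 2) ∈ Metric.ball μs (ρ / 3)) (hprev : R.μ (j + 1) ∈ Metric.ball μs (ρ / 3)) :
    R.InterpolatesNear S G (j + 1) := by
  have hsub : Metric.ball μs (ρ / 3) ⊆ Metric.ball μs ρ :=
    Metric.ball_subset_ball (by linarith [Metric.pos_of_mem_ball hlast])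
  rcases h with ⟨rfl, h⟩ | h
  · exact h.interpolatesNear hj hG (hsub hlast) (hsub hprev)
  · exact h.interpolatesNear hj j.succ_pos hG hlast hprev

end Runs

section InverseHessian

variable {d : ℕ} {F : Param d → ℝ} {μs : Param d}

/-- The stationary frequency branch `w` of `φ` through `(μk, ωk)` exists and is unique, and both the
Hessians of `F` and of `φ` along `w` at `μk` and their inverses agree up to the error `ε`. -/
def TracksInverseHessian (φ : Param d → ℝ → ℝ) (F : Param d → ℝ) (μs : Param d) (ωs ημ ηω : ℝ)
    (μk : Param d) (ωk ε : ℝ) : Prop :=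
  ∃ w : Param d → ℝ, IsFrequencyBranch φ μs ωs ημ ηω μk ωk w ∧
    (∀ w', IsFrequencyBranch φ μs ωs ημ ηω μk ωk w' → EqOn w' w (Metric.closedBall μs ημ)) ∧
    ContDiffAt ℝ 2 F μk ∧ ContDiffAt ℝ 2 (fun μ => φ μ (w μ)) μk ∧
    ‖hessian F μk - hessian (fun μ => φ μ (w μ)) μk‖ ≤ ε ∧
    IsUnit (hessian F μk) ∧ IsUnit (hessian (fun μ => φ μ (w μ)) μk) ∧
    ‖(hessian F μk)⁻¹ - (hessian (fun μ => φ μ (w μ)) μk)⁻¹‖ ≤ ε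

theorem exists_eventually_norm_inv_hessian_sub_le (hF : ContDiffAt ℝ 2 F μs)
    (hHess : IsUnit (hessian F μs)) :
    ∃ K : ℝ, ∀ᶠ z in 𝓝 (μs, (0 : Matrix (Fin d) (Fin d) ℝ)),
      IsUnit (hessian F z.1) ∧ IsUnit (hessian F z.1 - z.2) ∧
        ‖(hessian F z.1)⁻¹ - (hessian F z.1 - z.2)⁻¹‖ ≤ K * ‖z.2‖ := by
  obtain ⟨K, hK⟩ := exists_norm_inv_sub_inv_le hHess
  have hfst : ContinuousAt (fun z : Param d × Matrix (Fin d) (Fin d) ℝ => hessian F z.1) (μs, 0) :=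
    ContinuousAt.comp (g := hessian F) (f := Prod.fst) (continuousAt_hessian hF) continuousAt_fst
  have hlim : Tendsto (fun z : Param d × Matrix (Fin d) (Fin d) ℝ =>
      (hessian F z.1, hessian F z.1 - z.2)) (𝓝 (μs, 0)) (𝓝 (hessian F μs, hessian F μs)) := by
    simpa only [sub_zero] using
      hfst.tendsto.prodMk_nhds (hfst.tendsto.sub (tendsto_snd.mono_left nhds_prod_eq.le))
  refine ⟨K, (hlim.eventually hK).mono fun z hz => ?_⟩
  simpa only [sub_sub_cancel] using hz

theorem exists_eventually_tracksInverseHessian (hF : ContDiffAt ℝ 2 F μs)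
    (hHess : IsUnit (hessian F μs)) :
    ∃ K > 0, ∀ᶠ t : ℝ in 𝓝[>] 0, ∀ φ : Param d → ℝ → ℝ, ∀ ωs ημ ηω ωk h : ℝ,
      ∀ μ ∈ Metric.ball μs (t ^ 3), h < t ^ 3 →
        TracksHessian φ F μs ωs ημ ηω μ ωk (t⁻¹ * h) →
        TracksInverseHessian φ F μs ωs ημ ηω μ ωk (K * t⁻¹ * h) := by
  obtain ⟨K, hK⟩ := exists_eventually_norm_inv_hessian_sub_le hF hHess
  have hFnear : ∀ᶠ z in 𝓝 (μs, (0 : Matrix (Fin d) (Fin d) ℝ)), ContDiffAt ℝ 2 F z.1 :=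
    continuousAt_fst.eventually (hF.eventually (by simp))
  have hlim : Tendsto (fun t : ℝ => t ^ 2) (𝓝[>] 0) (𝓝 0) :=
    (Continuous.tendsto' (by fun_prop) _ _ (by simp)).mono_left nhdsWithin_le_nhds
  have hball := eventually_forall_mem_closedBall (x₀ := ()) tendsto_const_nhds hlim
    (continuousAt_snd.eventually (hK.and hFnear))
  refine ⟨max 1 K, by positivity, ?_⟩
  filter_upwards [hball, Ioo_mem_nhdsGT one_pos] with t ht ht₁ φ ωs ημ ηω ωk h μ hμ hh hw
  obtain ⟨w, hbranch, hunique, hsmooth, hbound⟩ := hw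
  have ht0 : 0 < t := ht₁.1
  have hμt : dist μ μs ≤ t ^ 2 :=
    hμ.le.trans (pow_le_pow_of_le_one ht0.le ht₁.2.le (Nat.le_succ 2))
  have hht : t⁻¹ * h ≤ t ^ 2 := by
    rw [inv_mul_le_iff₀ ht0, ← pow_succ']
    exact hh.le
  obtain ⟨⟨hunit, hunit', hinv⟩, hsmoothF⟩ :=
    ht (μ, hessian F μ - hessian (fun ν => φ ν (w ν)) μ)
      (max_le hμt (by rw [dist_zero_right]; exact hbound.trans hht))
  rw [sub_sub_cancel] at hunit' hinv
  have hh0 : 0 ≤ t⁻¹ * h := (norm_nonneg _).trans hbound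
  rw [mul_assoc]
  refine ⟨w, hbranch, hunique, hsmoothF, hsmooth, hbound.trans ?_, hunit, hunit', hinv.trans ?_⟩
  · exact le_mul_of_one_le_left hh0 (le_max_left _ _)
  · exact mul_le_mul (le_max_right _ _) hbound (norm_nonneg _) (by positivity)

end InverseHessian

namespace Descriptor

variable {d n m p : ℕ} {P : Param d → Descriptor n m p} {G : Param d → ℝ} {μs : Param d}
  {β δ : ℝ}

/-- Near `μs` the systems `P μ` belong to `H_∞`, depend smoothly on `μ`, and `σ` has a unique peak,
namely at `G μ`. At this peak `σ` is positive and smooth, the latter being encoded as smoothness of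
the spectral norm at the value of the transfer function. -/
structure IsSmoothPeakBranch (P : Param d → Descriptor n m p) (G : Param d → ℝ)
    (μs : Param d) : Prop where
  family : ContDiffFamilyAt 4 P μs
  contDiffAt : ContDiffAt ℝ 3 G μs
  det_ne_zero : ((P μs).D (Complex.I * G μs)).det ≠ 0
  H_ne_zero : (P μs).H (Complex.I * G μs) ≠ 0
  contDiffAt_norm : ContDiffAt ℝ 4 (‖·‖) ((P μs).H (Complex.I * G μs))
  isHinf : ∀ᶠ μ in 𝓝 μs, (P μ).IsHinf
  isPeak_iff : ∀ᶠ μ in 𝓝 μs, ∀ ω, (P μ).IsPeak ω ↔ ω = G μ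

namespace IsSmoothPeakBranch

theorem isPeak (h : IsSmoothPeakBranch P G μs) : ∀ᶠ μ in 𝓝 μs, (P μ).IsPeak (G μ) :=
  h.isPeak_iff.mono fun _ hμ => (hμ _).2 rfl

theorem contDiffAt_hinfNorm (h : IsSmoothPeakBranch P G μs) :
    ContDiffAt ℝ 3 (fun μ => (P μ).hinfNorm) μs :=
  Descriptor.contDiffAt_hinfNorm (h.family.of_le (by norm_num)) h.contDiffAt h.det_ne_zero
    (h.contDiffAt_norm.of_le (by norm_num)) h.isHinf h.isPeak

theorem eventually_agreesToFirstOrderAt (h : IsSmoothPeakBranch P G μs) :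
    ∀ᶠ μ in 𝓝 μs, AgreesToFirstOrderAt (fun z => (P z.1).sigma z.2) (fun ν => (P ν).hinfNorm)
      (μ, G μ) :=
  eventually_agreesToFirstOrderAt_hinfNorm (h.family.of_le (by norm_num))
    (h.contDiffAt.of_le (by norm_num)) h.det_ne_zero (h.contDiffAt_norm.of_le (by norm_num))
    h.isHinf h.isPeak

theorem eventually_forall_hasHessianBound (h : IsSmoothPeakBranch P G μs) (hδ : δ < 0)
    (hβ : 0 < β) :
    ∀ᶠ t : ℝ in 𝓝[>] 0, ∀ r : ℕ, ∀ θ ∈ admissibleBases ((P μs).D (Complex.I * G μs)) r β,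
      iteratedDeriv 2 ((P μs).reduce θ.1 θ.2).sigma (G μs) ≤ δ →
      HasHessianBound (fun ν => ((P ν).reduce θ.1 θ.2).sigma) (fun ν => (P ν).hinfNorm) G
        {μ | (P μ).InterpolatedBy θ.1 θ.2 (G μ)} μs t := by
  have hfixed : ∀ r ∈ Finset.range (n + 1), ∀ᶠ t : ℝ in 𝓝[>] 0,
      ∀ θ ∈ admissibleBases ((P μs).D (Complex.I * G μs)) r β,
      iteratedDeriv 2 ((P μs).reduce θ.1 θ.2).sigma (G μs) ≤ δ →
      HasHessianBound (fun ν => ((P ν).reduce θ.1 θ.2).sigma) (fun ν => (P ν).hinfNorm) G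
        {μ | (P μ).InterpolatedBy θ.1 θ.2 (G μ)} μs t := fun r _ =>
    eventually_forall_mem_of_isCompact (isCompact_admissibleBases _ r β) fun θ hθ =>
      eventually_hasHessianBound_reduce hδ h.family h.contDiffAt_hinfNorm
        (h.contDiffAt.of_le (by norm_num)) h.det_ne_zero
        (reduce_D (P μs) .. ▸ det_ne_zero_of_forall_mul_norm_le hβ hθ.2.2) h.H_ne_zero
        h.contDiffAt_norm h.eventually_agreesToFirstOrderAt
  filter_upwards [(eventually_all_finset _).2 hfixed] with t ht r θ hθ
  exact ht r (Finset.mem_range_succ_iff.2 (card_le_of_conjTranspose_mul_self_eq_one hθ.1)) θ hθ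

end IsSmoothPeakBranch

end Descriptor

variable {d n m p : ℕ} {S : ParamSystem d n m p} {Ω : Set (Param d)} {G : Param d → ℝ}
  {μs : Param d}

theorem mem_admissibleBases_of_le_sigmaMin {r : ℕ} {V W : Matrix (Fin n) (Fin r) ℂ}
    {M : Matrix (Fin n) (Fin n) ℂ} {β : ℝ} (hV : Vᴴ * V = 1) (hW : Wᴴ * W = 1)
    (h : β ≤ sigmaMin (Wᴴ * M * V)) : (V, W) ∈ admissibleBases M r β :=
  ⟨hV, hW, fun x =>
    (mul_le_mul_of_nonneg_right h (norm_nonneg x)).trans (sigmaMin_mul_norm_le _ x)⟩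

theorem det_ne_zero_of_le_sigmaMin {M : Matrix (Fin n) (Fin n) ℂ} {β : ℝ} (hβ : 0 < β)
    (h : β ≤ sigmaMin M) : M.det ≠ 0 :=
  det_ne_zero_of_forall_mul_norm_le hβ fun x =>
    (mul_le_mul_of_nonneg_right h (norm_nonneg x)).trans (sigmaMin_mul_norm_le M x)

theorem ParamSystem.IsAnalytic.exists_isSmoothPeakBranch (hS : S.IsAnalytic Ω) (hμs : μs ∈ Ω)
    (hnear : ∀ᶠ μ in 𝓝 μs, (S.full μ).IsHinf)
    (hcont : ∀ ω : OnePoint ℝ, ContinuousAt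
      (fun x : Param d × OnePoint ℝ => (S.full x.1).sigmaExt x.2) (μs, ω))
    {ωs : ℝ} (hmax : ∀ ω : OnePoint ℝ, ω ≠ ωs → (S.full μs).sigmaExt ω < (S.full μs).sigma ωs)
    (hpos : 0 < (S.full μs).sigma ωs)
    (hsimple : sigmaSecond ((S.full μs).H (Complex.I * ωs)) < (S.full μs).sigma ωs)
    (hωω : iteratedDeriv 2 (S.full μs).sigma ωs ≠ 0)
    (hdet : ((S.full μs).D (Complex.I * ωs)).det ≠ 0) :
    ∃ G : Param d → ℝ, G μs = ωs ∧ Descriptor.IsSmoothPeakBranch S.full G μs := by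
  rw [Descriptor.sigma_eq_norm] at hpos hsimple
  have hP (k : WithTop ℕ∞) := hS.contDiffFamilyAt hμs k
  have hn {k : WithTop ℕ∞} (hk : k ≠ 0) := contDiffAt_norm_of_simple hpos hsimple hk
  obtain ⟨G, hG, rfl, hpeak⟩ := Descriptor.exists_peak_branch (k := 3) (by norm_num) (hP _) hdet
    (hn (by norm_num)) hcont hmax hωω
  exact ⟨G, rfl, hP 4, hG, hdet, norm_pos_iff.1 hpos, hn (by norm_num), hnear, hpeak⟩

/-- The scale `t` and the constant `K` depend only on the full problem. -/
theorem Descriptor.IsSmoothPeakBranch.exists_tracksInverseHessian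
    (hG : IsSmoothPeakBranch S.full G μs) (hΩ : Ω ∈ 𝓝 μs)
    (hHess : IsUnit (hessian (fun μ => (S.full μ).hinfNorm) μs))
    {δ β : ℝ} (hδ : δ < 0) (hβ : 0 < β) :
    ∃ K > 0, ∃ t ∈ Ioo (0 : ℝ) 1, Metric.closedBall μs (t ^ 2) ⊆ Ω ∧
      (∀ μ ∈ Metric.ball μs (t ^ 3), ∀ ω, (S.full μ).IsPeak ω → ω = G μ) ∧
      ∀ (R : Run d n) (j : ℕ), R.InterpolatesNear S G j → R.μ (j + 1) ∈ Metric.ball μs (t ^ 3) →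
        ‖R.μ (j + 1) - R.μ j‖ ∈ Ioo 0 (t ^ 3) →
        iteratedDeriv 2 (S.reduced (R.V (j + 1)) (R.W (j + 1)) μs).sigma (G μs) ≤ δ →
        β ≤ sigmaMin ((S.reduced (R.V (j + 1)) (R.W (j + 1)) μs).D (Complex.I * G μs)) →
        TracksInverseHessian (fun μ => (S.reduced (R.V (j + 1)) (R.W (j + 1)) μ).sigma)
          (fun μ => (S.full μ).hinfNorm) μs (G μs) (t ^ 2) t (R.μ (j + 1)) (R.ω (j + 1))
          (K * t⁻¹ * ‖R.μ (j + 1) - R.μ j‖) := by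
  obtain ⟨K, hK, htrack⟩ :=
    exists_eventually_tracksInverseHessian (hG.contDiffAt_hinfNorm.of_le (by norm_num)) hHess
  have hlim : Tendsto (fun t : ℝ => t ^ 2) (𝓝[>] 0) (𝓝 0) :=
    (Continuous.tendsto' (by fun_prop) _ _ (by simp)).mono_left nhdsWithin_le_nhds
  have hball := eventually_forall_mem_closedBall (x₀ := ()) tendsto_const_nhds hlim
    (continuousAt_snd.eventually ((eventually_mem_set.2 hΩ).and hG.isPeak_iff))
  obtain ⟨t, ht, htrack, hscale, hball⟩ := (Eventually.and (Ioo_mem_nhdsGT one_pos)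
    (htrack.and ((hG.eventually_forall_hasHessianBound hδ hβ).and hball))).exists
  have hsub : Metric.ball μs (t ^ 3) ⊆ Metric.closedBall μs (t ^ 2) :=
    (Metric.ball_subset_ball (pow_le_pow_of_le_one ht.1.le ht.2.le (Nat.le_succ 2))).trans
      Metric.ball_subset_closedBall
  refine ⟨K, hK, t, ht, fun μ hμ => (hball μ hμ).1,
    fun μ hμ ω => ((hball μ (hsub hμ)).2 ω).1, fun R j hR hμ hh hωω hD => ?_⟩
  obtain ⟨s, hs, hsI⟩ := hR.exists_neighbour
  simp only [ParamSystem.reduced_eq] at hωω hD ⊢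
  rw [reduce_D] at hD
  rw [hR.ω_eq]
  exact htrack _ _ _ _ _ _ _ hμ hh.2 <| hscale _ _
    (mem_admissibleBases_of_le_sigmaMin hR.orthonormal.1 hR.orthonormal.2 hD) hωω _ hμ _ hh s hs
    hR.interpolatedBy hsI

end HinfMin

theorem lemma3p6_general {d n m p : ℕ} (S : HinfMin.ParamSystem d n m p)
    (Ω : Set (HinfMin.Param d)) (hΩ : IsOpen Ω) (hS : S.IsAnalytic Ω) (Ωc : Set (HinfMin.Param d))
    (μs : HinfMin.Param d) (hμs : μs ∈ Ω)
    (hnear : ∀ᶠ μ in 𝓝 μs, (S.full μ).IsHinf)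
    (hcont : ∀ ω : OnePoint ℝ, ContinuousAt
      (fun x : HinfMin.Param d × OnePoint ℝ => (S.full x.1).sigmaExt x.2) (μs, ω))
    (ωs : ℝ)
    (hmax : ∀ ω : OnePoint ℝ, ω ≠ (ωs : OnePoint ℝ) →
      (S.full μs).sigmaExt ω < (S.full μs).sigma ωs)
    (hpos : 0 < (S.full μs).sigma ωs)
    (hsimple : HinfMin.sigmaSecond ((S.full μs).H (Complex.I * ωs)) < (S.full μs).sigma ωs)
    (δ β : ℝ) (hδ : δ < 0) (hβ : 0 < β)
    (hωω : iteratedDeriv 2 (S.full μs).sigma ωs ≤ δ)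
    (hD : β ≤ HinfMin.sigmaMin ((S.full μs).D (Complex.I * ωs)))
    (hHess : IsUnit (HinfMin.hessian (fun μ => (S.full μ).hinfNorm) μs))
    (k : ℕ) (hk : 2 ≤ k) (𝓡 : Set (HinfMin.Run d n))
    (hRuns : (d = 1 ∧ ∀ R ∈ 𝓡, HinfMin.IsBasicRun S Ωc k R) ∨
      (∀ R ∈ 𝓡, HinfMin.IsExtendedRun S Ω Ωc k R))
    (hconv : ∀ j ∈ ({k - 1, k} : Set ℕ),
      Tendsto (fun R : HinfMin.Run d n => R.μ j)
        (comap (fun R : HinfMin.Run d n => R.μ 1) (𝓝 μs) ⊓ 𝓟 𝓡) (𝓝 μs)) :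
    ∃ ζ > 0, ∃ ρ > 0, ∃ ημ > 0, ∃ ηω > 0, Metric.closedBall μs ημ ⊆ Ω ∧
      ∀ R ∈ 𝓡, ‖R.μ 1 - μs‖ < ρ → R.μ k ≠ R.μ (k - 1) →
        iteratedDeriv 2 (S.reduced (R.V k) (R.W k) μs).sigma ωs ≤ δ →
        β ≤ HinfMin.sigmaMin ((S.reduced (R.V k) (R.W k) μs).D (Complex.I * ωs)) →
        R.μ k ∈ interior (Metric.closedBall μs ημ) ∧
        HinfMin.TracksInverseHessian (fun μ => (S.reduced (R.V k) (R.W k) μ).sigma)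
          (fun μ => (S.full μ).hinfNorm) μs ωs ημ ηω (R.μ k) (R.ω k)
          (ζ * ‖R.μ k - R.μ (k - 1)‖) := by
  obtain ⟨G, rfl, hG⟩ := hS.exists_isSmoothPeakBranch hμs hnear hcont hmax hpos hsimple
    (hωω.trans_lt hδ).ne (HinfMin.det_ne_zero_of_le_sigmaMin hβ hD)
  obtain ⟨K, hK, t, ⟨ht₀, ht₁⟩, hball, hpeak, htracks⟩ :=
    hG.exists_tracksInverseHessian (hΩ.mem_nhds hμs) hHess hδ hβ
  obtain ⟨j, rfl⟩ := Nat.exists_eq_add_of_le' hk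
  have hnear (i : ℕ) (hi : i ∈ ({j + 1, j + 2} : Set ℕ)) :=
    (hconv i hi).eventually (Metric.ball_mem_nhds μs (by positivity : 0 < t ^ 3 / 3))
  obtain ⟨ρ, hρ, hclose⟩ := Metric.eventually_nhds_iff.1 <| eventually_comap.1 <|
    eventually_inf_principal.1 ((hnear (j + 1) (.inl rfl)).and (hnear (j + 2) (.inr rfl)))
  refine ⟨K * t⁻¹, by positivity, ρ, hρ, t ^ 2, by positivity, t, ht₀, hball,
    fun R hR hR₁ hne hωω' hD' => ?_⟩
  obtain ⟨hprev, hlast⟩ := hclose (dist_eq_norm (R.μ 1) μs ▸ hR₁) R rfl hR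
  have hlast' : R.μ (j + 2) ∈ Metric.ball μs (t ^ 3) :=
    Metric.ball_subset_ball (by linarith [pow_pos ht₀ 3]) hlast
  have hstep : ‖R.μ (j + 2) - R.μ (j + 1)‖ < t ^ 3 := by
    rw [← dist_eq_norm]
    linarith [dist_triangle_right (R.μ (j + 2)) (R.μ (j + 1)) μs, Metric.mem_ball.1 hprev,
      Metric.mem_ball.1 hlast, pow_pos ht₀ 3]
  refine ⟨interior_mono Metric.ball_subset_closedBall ?_, htracks R (j + 1)
    (HinfMin.interpolatesNear_of_isBasicRun_or_isExtendedRun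
      (hRuns.imp (fun h => ⟨h.1, h.2 R hR⟩) fun h => h R hR) (by omega) hpeak hlast hprev) hlast'
    ⟨norm_sub_pos_iff.2 hne, hstep⟩ hωω' hD'⟩
  rw [Metric.isOpen_ball.interior_eq]
  exact Metric.ball_subset_ball (pow_le_pow_of_le_one ht₀.le ht₁.le (Nat.le_succ 2)) hlast'

theorem lemma3p6 {d n m p : ℕ} (S : HinfMin.ParamSystem d n m p)
    -- the parameter domain, the coefficients, the admissible set
    (Ω : Set (HinfMin.Param d)) (hΩopen : IsOpen Ω) (hΩbdd : Bornology.IsBounded Ω)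
    (hS : S.IsAnalytic Ω)
    (Ωc : Set (HinfMin.Param d)) (hΩc : IsCompact Ωc) (hsub : Ωc ⊆ Ω)
    (hHinf : ∀ μ ∈ Ωc, (S.full μ).IsHinf)
    -- the minimizer
    (μs : HinfMin.Param d) (hμs : μs ∈ Ωc)
    (hmin : IsLocalMinOn (fun μ => (S.full μ).hinfNorm) Ωc μs)
    (hnear : ∀ᶠ μ in 𝓝 μs, (S.full μ).IsHinf)
    (hcont : ∀ ω : OnePoint ℝ, ContinuousAt
      (fun x : HinfMin.Param d × OnePoint ℝ => (S.full x.1).sigmaExt x.2) (μs, ω))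
    -- the smoothness assumption
    (ωs : ℝ)
    (hmax : ∀ ω : OnePoint ℝ, ω ≠ (ωs : OnePoint ℝ) →
      (S.full μs).sigmaExt ω < (S.full μs).sigma ωs)
    (hpos : 0 < (S.full μs).sigma ωs)
    (hsimple : HinfMin.sigmaSecond ((S.full μs).H (Complex.I * ωs)) < (S.full μs).sigma ωs)
    -- the remaining assumptions on the full problem
    (δ β : ℝ) (hδ : δ < 0) (hβ : 0 < β)
    (hωω : iteratedDeriv 2 (S.full μs).sigma ωs ≤ δ)
    (hD : β ≤ HinfMin.sigmaMin ((S.full μs).D (Complex.I * ωs)))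
    (hHess : IsUnit (HinfMin.hessian (fun μ => (S.full μ).hinfNorm) μs))
    -- a family of runs with `k` steps, in which `μ^(k), μ^(k-1) → μs` as `μ^(1) → μs`
    (k : ℕ) (hk : 2 ≤ k) (𝓡 : Set (HinfMin.Run d n))
    (hRuns : (d = 1 ∧ ∀ R ∈ 𝓡, HinfMin.IsBasicRun S Ωc k R) ∨
      (∀ R ∈ 𝓡, HinfMin.IsExtendedRun S Ω Ωc k R))
    (hconv : ∀ j ∈ ({k - 1, k} : Set ℕ),
      Tendsto (fun R : HinfMin.Run d n => R.μ j)
        (comap (fun R : HinfMin.Run d n => R.μ 1) (𝓝 μs) ⊓ 𝓟 𝓡) (𝓝 μs)) :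
    ∃ ζ > 0, ∃ ρ > 0, ∃ ημ > 0, ∃ ηω > 0, Metric.closedBall μs ημ ⊆ Ω ∧
      ∀ R ∈ 𝓡, ‖R.μ 1 - μs‖ < ρ → R.μ k ≠ R.μ (k - 1) →
        iteratedDeriv 2 (S.reduced (R.V k) (R.W k) μs).sigma ωs ≤ δ →
        β ≤ HinfMin.sigmaMin ((S.reduced (R.V k) (R.W k) μs).D (Complex.I * ωs)) →
        R.μ k ∈ interior (Metric.closedBall μs ημ) ∧
        ∃ w : HinfMin.Param d → ℝ,
          -- `w` is the frequency function of the reduced problem, and it is unique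
          HinfMin.IsFrequencyBranch (fun μ => (S.reduced (R.V k) (R.W k) μ).sigma)
            μs ωs ημ ηω (R.μ k) (R.ω k) w ∧
          (∀ w' : HinfMin.Param d → ℝ,
            HinfMin.IsFrequencyBranch (fun μ => (S.reduced (R.V k) (R.W k) μ).sigma)
              μs ωs ημ ηω (R.μ k) (R.ω k) w' → EqOn w' w (Metric.closedBall μs ημ)) ∧
          -- both functions are twice continuously differentiable at `μ^(k)`
          ContDiffAt ℝ 2 (fun μ => (S.full μ).hinfNorm) (R.μ k) ∧
          ContDiffAt ℝ 2 (fun μ => (S.reduced (R.V k) (R.W k) μ).sigma (w μ)) (R.μ k) ∧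
          -- (i)
          ‖HinfMin.hessian (fun μ => (S.full μ).hinfNorm) (R.μ k) -
            HinfMin.hessian (fun μ => (S.reduced (R.V k) (R.W k) μ).sigma (w μ)) (R.μ k)‖
            ≤ ζ * ‖R.μ k - R.μ (k - 1)‖ ∧
          -- (ii)
          IsUnit (HinfMin.hessian (fun μ => (S.full μ).hinfNorm) (R.μ k)) ∧
          IsUnit (HinfMin.hessian
            (fun μ => (S.reduced (R.V k) (R.W k) μ).sigma (w μ)) (R.μ k)) ∧
          -- (iii)
          ‖(HinfMin.hessian (fun μ => (S.full μ).hinfNorm) (R.μ k))⁻¹ -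
            (HinfMin.hessian
              (fun μ => (S.reduced (R.V k) (R.W k) μ).sigma (w μ)) (R.μ k))⁻¹‖
            ≤ ζ * ‖R.μ k - R.μ (k - 1)‖ := by
  exact lemma3p6_general S Ω hΩopen hS Ωc μs (hsub hμs) hnear hcont ωs hmax hpos hsimple δ β hδ hβ
    hωω hD hHess k hk 𝓡 hRuns hconv
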